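/- Let $I=[0,1]$ with Lebesgue measure and $S^1=\mathbb R/2\pi\mathbb Z$. On the phase space $L^\infty(I;S^1)$, with the distance $\operatorname{ess\,sup}_\xi|x(\xi)-y(\xi)|_{S^1}$, consider the continuum limit of the Kuramoto model of identical oscillators, $$\partial_t x(t,\xi)=\int_0^1\sin\big(x(t,z)-x(t,\xi)\big)\,dz, \qquad (1)$$ where a solution on an interval $J\subseteq\mathbb R$ is a curve $x:J\to L^\infty(I;S^1)$ having a real-valued lift $J\to L^\infty(I;\mathbb R)$ which is differentiable (one-sidedly at end points belonging to $J$) and satisfies (1). The unstable manifold $W^u(e)$ of an equilibrium $e$ is the set of all $x_0$ for which there is a solution $x$ on $(-\infty,0]$ with $x(0)=x_0$ and $x(t)\to e$ as $t\to-\infty$. For $\beta\in[0,1)$ and $\alpha\in\mathbb R$ let $$f_{\alpha,\beta}(\theta)=\frac1{2\pi}\,\frac{1-\beta^2}{1-2\beta\cos(\alpha+\theta)+\beta^2},\qquad F_{\alpha,\beta}(\theta)=\int_0^\theta f_{\alpha,\beta}(\varphi)\,d\varphi,\qquad C(\alpha,\beta)=-\frac1\pi\arctan\Big(\frac{\beta\sin\alpha}{1-\beta\cos\alpha}\Big)$$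 be the Ott–Antonsen densities, their circular distribution functions, and a phase shift; $F_{\alpha,\beta}:\mathbb R\to\mathbb R$ is a bijection with $F_{\alpha,\beta}(\theta+2\pi)=F_{\alpha,\beta}(\theta)+1$, so that $F_{\alpha,\beta}^{-1}$ induces a map $\mathbb R/\mathbb Z\to S^1$. Let $q\in\mathbb R$ (only its class in $\mathbb R/2\pi\mathbb Z$ matters), $y_q(\xi)=2\pi\xi+q$, and $$\Theta_{\alpha,\beta}(\xi)=F^{-1}_{\alpha,\beta}\Big(\xi+C(\alpha,\beta)+\frac q{2\pi}\Big)\in S^1 .$$ **Theorem.** The twisted state $y_q$ is an equilibrium of (1), and $$W^u(y_q)=\{\Theta_{\alpha,\beta}\;:\;\beta\in[0,1),\ \alpha\in[-\pi,\pi]\}.$$ This set is a two-dimensional smooth embedded submanifold of $L^\infty(I;S^1)$: the map $\beta e^{i\alpha}\mapsto\Theta_{\alpha,\beta}$ is well defined on the open unit disc of $\mathbb C=\mathbb R^2$, is a homeomorphism onto $W^u(y_q)$, and has a lift to $L^\infty(I;\mathbb R)$ which is $C^\infty$ with everywhere injective real derivative. For every solution $x$ on $(-\infty,0]$ with $x(0)\in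 W^u(y_q)$ there is a $K$ such that the distance of $x(t)$ to $y_q$ is at most $Ke^{t/2}$ for all $t\le0$. Moreover, the parameters evolve by $$\dot\beta=\tfrac12\beta(1-\beta^2),\qquad \dot\alpha=0 \qquad (2)$$ in the following sense, where (2) is read in polar coordinates, that is, $\dot\alpha=0$ is required only at times when $\beta\neq0$. Let $J$ be an interval. If $\alpha:J\to\mathbb R$ and $\beta:J\to[0,1)$ are differentiable, then $t\mapsto\Theta_{\alpha(t),\beta(t)}$ is a solution of (1) on $J$ if and only if $(\alpha,\beta)$ solves (2) on $J$. Every solution of (1) on $J$ that lies in $W^u(y_q)$ at some time of $J$ is of the form $t\mapsto\Theta_{\alpha,\beta(t)}$ on all of $J$, with a constant $\alpha\in[-\pi,\pi]$ and a solution $\beta:J\to[0,1)$ of (2). -/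

import Mathlib

open MeasureTheory Set Filter Topology
open scoped Real ENNReal unitInterval

noncomputable section

namespace Kuramoto

/-! ### The continuum limit equation on the phase space `L^∞(I; S¹)` -/

/-- The phase space `L^∞(I; S¹)`, with `I = [0,1]` carrying Lebesgue measure and
`S¹ = ℝ / 2πℤ`: classes (modulo null sets) of measurable maps `I → S¹`, with the distance
`ess sup |x(ξ) - y(ξ)|_{S¹}`. -/
abbrev CirclePhase : Type := Lp Real.Angle ∞ (volume : Measure I)

/-- The Banach space `L^∞(I; ℝ)`, which is the tangent space of `L^∞(I; S¹)` at every point. -/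
abbrev RealPhase : Type := Lp ℝ ∞ (volume : Measure I)

theorem lipschitzWith_angleCoe : LipschitzWith 1 ((↑) : ℝ → Real.Angle) := by
  refine LipschitzWith.of_dist_le_mul fun x y => ?_
  rw [dist_eq_norm, dist_eq_norm, ← Real.Angle.coe_sub, NNReal.coe_one, one_mul]
  exact QuotientAddGroup.norm_mk_le_norm

/-- Reduction modulo `2π`: the class of `X` is sent to the class of `ξ ↦ X(ξ) mod 2π`. -/
def modTwoPi (X : RealPhase) : CirclePhase :=
  lipschitzWith_angleCoe.compLp Real.Angle.coe_zero X

theorem coeFn_modTwoPi (X : RealPhase) :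
    modTwoPi X =ᵐ[volume] fun ξ => ((X ξ : ℝ) : Real.Angle) :=
  lipschitzWith_angleCoe.coeFn_compLp Real.Angle.coe_zero X

theorem memLp_kuramoto (x : CirclePhase) :
    MemLp (fun ξ : I => ∫ z : I, (x z - x ξ).sin) ∞ (volume : Measure I) := by
  have hb : ∀ s : Real.Angle, ‖s.sin‖ ≤ 1 := fun s => by
    induction s using Real.Angle.induction_on with
    | h r => simpa using Real.abs_sin_le_one r
  have hc : Continuous fun s : Real.Angle => ∫ z : I, (x z - s).sin := by
    refine continuous_of_dominated (bound := fun _ => 1) (fun s => ?_)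
      (fun s => ae_of_all _ fun z => hb _) (integrable_const _) (ae_of_all _ fun z => ?_)
    · exact Real.Angle.continuous_sin.comp_aestronglyMeasurable
        ((Lp.aestronglyMeasurable x).sub aestronglyMeasurable_const)
    · exact Real.Angle.continuous_sin.comp (continuous_const.sub continuous_id)
  refine memLp_top_of_bound (hc.comp_aestronglyMeasurable (Lp.aestronglyMeasurable x)) 1
    (ae_of_all _ fun ξ => ?_)
  refine (norm_integral_le_of_norm_le_const (ae_of_all _ fun z => hb _)).trans ?_
  simp

/-- The right-hand side of the Kuramoto continuum limit,
`ξ ↦ ∫₀¹ sin (x(z) - x(ξ)) dz`, as a vector field on `L^∞(I; S¹)`. -/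
def kuramotoField (x : CirclePhase) : RealPhase := (memLp_kuramoto x).toLp _

/-- `x` solves `∂ₜ x(t,ξ) = ∫₀¹ sin (x(t,z) - x(t,ξ)) dz` on the time set `J` (an interval):
the circle-valued curve `x` has a real-valued lift `X` which is differentiable in `L^∞(I; ℝ)`
on `J` (one-sidedly at end points), with derivative given by the vector field. -/
def IsSolutionOn (x : ℝ → CirclePhase) (J : Set ℝ) : Prop :=
  ∃ X : ℝ → RealPhase, ∀ t ∈ J,
    modTwoPi (X t) = x t ∧ HasDerivWithinAt X (kuramotoField (x t)) J t

/-- The unstable manifold of `e`: all initial data which possess a backward solution,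
defined for all `t ≤ 0`, that converges to `e` as `t → -∞`. -/
def unstableManifold (e : CirclePhase) : Set CirclePhase :=
  {x₀ | ∃ x : ℝ → CirclePhase, IsSolutionOn x (Iic 0) ∧ x 0 = x₀ ∧ Tendsto x atBot (𝓝 e)}

theorem memLp_twistedState (q : ℝ) :
    MemLp (fun ξ : I => 2 * π * (ξ : ℝ) + q) ∞ (volume : Measure I) := by
  refine memLp_top_of_bound (by fun_prop) (2 * π + |q|) (ae_of_all _ fun ξ => ?_)
  refine (norm_add_le _ _).trans (add_le_add ?_ le_rfl)
  rw [Real.norm_eq_abs, abs_of_nonneg (mul_nonneg Real.two_pi_pos.le ξ.2.1)]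
  exact mul_le_of_le_one_right Real.two_pi_pos.le ξ.2.2

/-- The twisted state `y_q(ξ) = 2πξ + q` (mod `2π`); it depends only on `q` mod `2π`. -/
def twistedState (q : ℝ) : CirclePhase := modTwoPi ((memLp_twistedState q).toLp _)

/-! ### Ott-Antonsen densities and their inverse circular distribution functions -/

/-- The Ott-Antonsen density `f_{α,β}(θ)`. -/
def oaDensity (α β θ : ℝ) : ℝ :=
  1 / (2 * π) * ((1 - β ^ 2) / (1 - 2 * β * Real.cos (α + θ) + β ^ 2))

/-- The circular distribution function `F_{α,β}(θ) = ∫₀^θ f_{α,β}`, lifted to a map `ℝ → ℝ`.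
As `f_{α,β}` is `2π`-periodic of mass one, `F_{α,β}(θ + 2π) = F_{α,β}(θ) + 1`, so that this is
the lift of a map `ℝ/2πℤ → ℝ/ℤ`. -/
def circularCDF (α β θ : ℝ) : ℝ := ∫ φ in (0 : ℝ)..θ, oaDensity α β φ

theorem oaDensity_den_pos {β : ℝ} (hβ : β ∈ Ico (0 : ℝ) 1) (α θ : ℝ) :
    0 < 1 - 2 * β * Real.cos (α + θ) + β ^ 2 := by
  have h1 := Real.cos_le_one (α + θ)
  have h2 : 0 < (1 - β) ^ 2 := pow_pos (sub_pos.2 hβ.2) 2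
  nlinarith [mul_nonneg hβ.1 (sub_nonneg.2 h1)]

theorem continuous_oaDensity {β : ℝ} (hβ : β ∈ Ico (0 : ℝ) 1) (α : ℝ) :
    Continuous (oaDensity α β) := by
  unfold oaDensity
  refine continuous_const.mul (continuous_const.div (by fun_prop) fun θ => ?_)
  exact (oaDensity_den_pos hβ α θ).ne'

theorem le_oaDensity {β : ℝ} (hβ : β ∈ Ico (0 : ℝ) 1) (α θ : ℝ) :
    1 / (2 * π) * ((1 - β ^ 2) / (1 + β) ^ 2) ≤ oaDensity α β θ := by
  have h0 : 0 ≤ 1 - β ^ 2 := by nlinarith [hβ.1, hβ.2]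
  have h1 := Real.neg_one_le_cos (α + θ)
  unfold oaDensity
  refine mul_le_mul_of_nonneg_left ?_ (by positivity)
  refine div_le_div_of_nonneg_left h0 (oaDensity_den_pos hβ α θ) ?_
  nlinarith [mul_nonneg hβ.1 (sub_nonneg.2 h1)]

/-- For `β ∈ [0,1)` the lifted circular distribution function is a bijection of `ℝ`. -/
theorem bijective_circularCDF {β : ℝ} (hβ : β ∈ Ico (0 : ℝ) 1) (α : ℝ) :
    Function.Bijective (circularCDF α β) := by
  set c : ℝ := 1 / (2 * π) * ((1 - β ^ 2) / (1 + β) ^ 2) with hc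
  have hc0 : 0 < c := by
    have h0 : 0 < 1 - β ^ 2 := by nlinarith [hβ.1, hβ.2]
    have h1 : 0 < 1 + β := by linarith [hβ.1]
    positivity
  have hcont := continuous_oaDensity hβ α
  have key : ∀ a b : ℝ, a ≤ b → c * (b - a) ≤ circularCDF α β b - circularCDF α β a := by
    intro a b hab
    unfold circularCDF
    rw [intervalIntegral.integral_interval_sub_left (hcont.intervalIntegrable _ _)
      (hcont.intervalIntegrable _ _)]
    have := intervalIntegral.integral_mono_on hab
      (continuous_const.intervalIntegrable (μ := volume) a b : IntervalIntegrable (fun _ : ℝ => c) volume a b) (hcont.intervalIntegrable a b)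
      fun θ _ => le_oaDensity hβ α θ
    rwa [intervalIntegral.integral_const, smul_eq_mul, mul_comm] at this
  have hmono : StrictMono (circularCDF α β) := fun a b hab => by
    have := key a b hab.le
    nlinarith [mul_pos hc0 (sub_pos.2 hab)]
  have h00 : circularCDF α β 0 = 0 := by simp [circularCDF]
  refine ⟨hmono.injective, Continuous.surjective ?_ ?_ ?_⟩
  · exact intervalIntegral.continuous_primitive (fun a b => hcont.intervalIntegrable a b) 0
  · refine tendsto_atTop_mono' _ ?_ (tendsto_id.const_mul_atTop hc0)
    filter_upwards [eventually_ge_atTop 0] with θ hθ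
    have := key 0 θ hθ
    simp only [id]
    linarith
  · refine tendsto_atBot_mono' _ ?_ (tendsto_id.const_mul_atBot hc0)
    filter_upwards [eventually_le_atBot 0] with θ hθ
    have := key θ 0 hθ
    simp only [id]
    linarith

/-- The inverse `F_{α,β}⁻¹ : ℝ → ℝ` of the (lifted) circular distribution function. Modulo `2π`
it is the inverse map `ℝ/ℤ → ℝ/2πℤ`. -/
def circularCDFInv (α β : ℝ) : ℝ → ℝ := Function.invFun (circularCDF α β)

/-- The phase shift `C(α,β)`. -/
def phaseShift (α β : ℝ) : ℝ :=
  -(1 / π) * Real.arctan (β * Real.sin α / (1 - β * Real.cos α))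

/-- The map `ξ ↦ F_{α,β}⁻¹(ξ + C(α,β) + q/(2π)) mod 2π` from `I` to the circle. -/
def oaState (q α β : ℝ) (ξ : I) : Real.Angle :=
  ((circularCDFInv α β ((ξ : ℝ) + phaseShift α β + q / (2 * π)) : ℝ) : Real.Angle)

/-- `W` is a two-dimensional smooth embedded submanifold of `L^∞(I; S¹)`, with the global
parametrization `w ↦ Φ(w) mod 2π` by the open unit disc of `ℂ = ℝ²`: the map `Φ` into
`L^∞(I; ℝ)` is smooth, its (real) derivative is injective at every point of the disc, and
`w ↦ Φ(w) mod 2π` is a homeomorphism of the disc onto `W`. -/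
structure IsSmoothDisc (W : Set CirclePhase) (Φ : ℂ → RealPhase) : Prop where
  smooth : ContDiffOn ℝ ((⊤ : ℕ∞) : WithTop ℕ∞) Φ (Metric.ball 0 1)
  immersive : ∀ w ∈ Metric.ball (0 : ℂ) 1, Function.Injective (fderiv ℝ Φ w)
  embedding : IsEmbedding fun w : Metric.ball (0 : ℂ) 1 => modTwoPi (Φ w)
  image_eq : (fun w => modTwoPi (Φ w)) '' Metric.ball 0 1 = W

/-- `(α, β)` solves `β' = β (1 - β²) / 2`, `α' = 0` on the time set `J`. The pair stands for the
point with polar coordinates `(β, α)`, so the angle `α` is not constrained at times when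
`β = 0`. -/
def SolvesParameterODE (α β : ℝ → ℝ) (J : Set ℝ) : Prop :=
  ∀ t ∈ J, HasDerivWithinAt β (β t * (1 - β t ^ 2) / 2) J t ∧
    (β t ≠ 0 → HasDerivWithinAt α 0 J t)

end Kuramoto

end

open Kuramoto

open scoped ComplexConjugate

noncomputable section

namespace Kuramoto

/-! ### Essential bounds -/

/-! Write `E = e^{i(2πξ+q)}`. The states reached from `y_q` are the images of `E` under the disc
automorphisms `z ↦ (z + w̄)/(1 + wz)`, `|w| < 1`. They have the explicit lift `2πξ + q - 2 arg (1 +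
wE)`, and inverting the Poisson kernel distribution function shows that `w = βe^{iα}` gives
`Θ_{α,β}`. By the mean value property, the order parameter `r = ∫ e^{ix}` of such a state is `w̄`,
and the second moment `m = ∫ e^{2ix}` is `w̄²`. Hence `x ↦ conj r` is a continuous left inverse of
the chart, which yields both the embedding and the immersion.

The field at `x` is `Im (r e^{-ix})`, so it sees `x` only through `r` and pointwise. On the disc it
equals the chart derivative in the radial direction `w(1 - |w|²)/2`. Solutions of the radial
equation therefore give solutions on the disc, tending to `y_q` like `e^{t/2}`. The field is
Lipschitz in the lift, so a solution that meets the disc is one of these.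

It remains to show that a backward solution converging to `y_q` meets the disc
(`IsSolutionOn.exists_mem_oaDisc`). From `r' = (r - r̄ m)/2` and `m → 0`, `r` decays exponentially
as `t → -∞`. The speed is at most `|r|`, so the lift converges too. Let `H` be the difference
between the lift, suitably shifted, and the disc state with the same order parameter. Then `‖H'‖ ≤
5|r|‖H‖` with `|r|` integrable at `-∞` and `H → 0`, and a Gronwall argument from `-∞` forces `H =
0`. -/

theorem norm_le_of_ae_norm_le {E : Type*} [NormedAddCommGroup E]
    (f : Lp E ∞ (volume : Measure I)) {C : ℝ} (hC : 0 ≤ C) (h : ∀ᵐ ξ, ‖f ξ‖ ≤ C) : ‖f‖ ≤ C := by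
  simpa using Lp.norm_le_of_ae_bound hC h

theorem ae_norm_coe_le_norm {E : Type*} [NormedAddCommGroup E]
    (f : Lp E ∞ (volume : Measure I)) : ∀ᵐ ξ, ‖f ξ‖ ≤ ‖f‖ := by
  have h := ae_le_eLpNormEssSup (f := (f : I → E)) (μ := volume)
  filter_upwards [h] with ξ hξ
  rw [Lp.norm_def, eLpNorm_exponent_top]
  have h2 : eLpNormEssSup (f : I → E) volume ≠ ∞ := by
    rw [← eLpNorm_exponent_top]; exact Lp.eLpNorm_ne_top f
  simpa using ENNReal.toReal_mono h2 hξ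

theorem ae_norm_sub_le {E : Type*} [NormedAddCommGroup E]
    (f g : Lp E ∞ (volume : Measure I)) : ∀ᵐ ξ, ‖f ξ - g ξ‖ ≤ ‖f - g‖ := by
  filter_upwards [ae_norm_coe_le_norm (f - g), Lp.coeFn_sub f g] with ξ h1 h2
  rwa [h2] at h1

theorem norm_sub_le_of_ae {E : Type*} [NormedAddCommGroup E]
    (f g : Lp E ∞ (volume : Measure I)) {C : ℝ} (hC : 0 ≤ C) (h : ∀ᵐ ξ, ‖f ξ - g ξ‖ ≤ C) :
    ‖f - g‖ ≤ C := by
  refine norm_le_of_ae_norm_le _ hC ?_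
  filter_upwards [h, Lp.coeFn_sub f g] with ξ h1 h2
  rwa [h2]

theorem norm_integral_sub_le {f g : I → ℂ} (hf : Integrable f) (hg : Integrable g) {C : ℝ}
    (h : ∀ᵐ ξ, ‖f ξ - g ξ‖ ≤ C) : ‖(∫ ξ, f ξ) - ∫ ξ, g ξ‖ ≤ C := by
  rw [← integral_sub hf hg]
  simpa using norm_integral_le_of_norm_le_const h

/-! ### Reduction modulo `2π` -/

theorem modTwoPi_add (X Y : RealPhase) : modTwoPi (X + Y) = modTwoPi X + modTwoPi Y := by
  refine Lp.ext ?_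
  filter_upwards [coeFn_modTwoPi (X + Y), coeFn_modTwoPi X, coeFn_modTwoPi Y, Lp.coeFn_add X Y,
    Lp.coeFn_add (modTwoPi X) (modTwoPi Y)] with ξ h1 h2 h3 h4 h5
  rw [h1, h5, h4, Pi.add_apply, Pi.add_apply, h2, h3, Real.Angle.coe_add]

theorem modTwoPi_sub (X Y : RealPhase) : modTwoPi (X - Y) = modTwoPi X - modTwoPi Y := by
  rw [eq_sub_iff_add_eq, ← modTwoPi_add, sub_add_cancel]

theorem norm_modTwoPi_sub_le (X Y : RealPhase) : ‖modTwoPi X - modTwoPi Y‖ ≤ ‖X - Y‖ := by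
  have h := lipschitzWith_angleCoe.norm_compLp_sub_le Real.Angle.coe_zero X Y
  rwa [NNReal.coe_one, one_mul] at h

theorem continuous_modTwoPi : Continuous modTwoPi :=
  lipschitzWith_angleCoe.continuous_compLp Real.Angle.coe_zero

/-! ### Phasors and order parameters -/

/-- The point `e^{is}` of the unit circle. -/
def phasor (s : Real.Angle) : ℂ := (s.toCircle : ℂ)

theorem phasor_coe (r : ℝ) : phasor (r : Real.Angle) = Complex.exp (r * Complex.I) := by
  simp [phasor, Circle.coe_exp]

theorem norm_phasor (s : Real.Angle) : ‖phasor s‖ = 1 := Circle.norm_coe _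

theorem phasor_sub (s t : Real.Angle) : phasor (s - t) = phasor s * conj (phasor t) := by
  rw [phasor, phasor, phasor, sub_eq_add_neg, Real.Angle.toCircle_add, Real.Angle.toCircle_neg,
    Circle.coe_mul, Circle.coe_inv_eq_conj]

theorem phasor_im (s : Real.Angle) : (phasor s).im = s.sin := by
  simp [phasor, Real.Angle.coe_toCircle]

theorem phasor_mul_conj (s : Real.Angle) : phasor s * conj (phasor s) = 1 := by
  rw [Complex.mul_conj, Complex.normSq_eq_norm_sq, norm_phasor]; simp

theorem norm_phasor_coe_sub_le (r s : ℝ) :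
    ‖phasor (r : Real.Angle) - phasor (s : Real.Angle)‖ ≤ |r - s| := by
  have h : phasor (r : Real.Angle) - phasor (s : Real.Angle)
      = phasor (s : Real.Angle) * (Complex.exp (Complex.I * (r - s : ℝ)) - 1) := by
    rw [phasor_coe, phasor_coe, mul_sub, ← Complex.exp_add, mul_one]
    congr 2
    push_cast; ring
  rw [h, norm_mul, norm_phasor, one_mul]
  exact Real.norm_exp_I_mul_ofReal_sub_one_le

theorem norm_phasor_sub_le (s t : Real.Angle) : ‖phasor s - phasor t‖ ≤ ‖s - t‖ := by
  refine le_of_forall_pos_le_add fun ε hε => ?_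
  -- The norm on the circle is an infimum over real representatives, so one is taken within `ε` of
  -- it.
  obtain ⟨r, hr, hr'⟩ := QuotientAddGroup.exists_norm_mk_lt (s - t) hε
  have hr2 : ((r : ℝ) : Real.Angle) = s - t := hr
  have h : phasor s - phasor t
      = phasor t * (phasor (r : Real.Angle) - phasor ((0 : ℝ) : Real.Angle)) := by
    rw [hr2, phasor_sub, mul_sub, mul_left_comm, phasor_mul_conj, phasor_coe 0]
    simp
  rw [h, norm_mul, norm_phasor, one_mul]
  refine (norm_phasor_coe_sub_le r 0).trans ?_
  rw [sub_zero]
  exact hr'.le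

theorem lipschitzWith_phasor : LipschitzWith 1 phasor :=
  LipschitzWith.of_dist_le_mul fun s t => by
    simpa [dist_eq_norm] using norm_phasor_sub_le s t

theorem integrable_phasor_comp {f : I → Real.Angle}
    (hf : AEStronglyMeasurable f (volume : Measure I)) : Integrable fun ξ => phasor (f ξ) :=
  Integrable.of_bound (lipschitzWith_phasor.continuous.comp_aestronglyMeasurable hf) 1
    (ae_of_all _ fun _ => (norm_phasor _).le)

theorem integrable_phasor (x : CirclePhase) : Integrable fun ξ => phasor (x ξ) :=
  integrable_phasor_comp (Lp.aestronglyMeasurable x)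

theorem integrable_phasor_sq (x : CirclePhase) : Integrable fun ξ => phasor (x ξ) ^ 2 :=
  Integrable.of_bound ((lipschitzWith_phasor.continuous.pow 2).comp_aestronglyMeasurable
    (Lp.aestronglyMeasurable x)) 1 (ae_of_all _ fun ξ => by simp [norm_phasor])

/-- The order parameter `∫ e^{ix}`. -/
def orderParam (x : CirclePhase) : ℂ := ∫ ξ, phasor (x ξ)

/-- The second moment `∫ e^{2ix}`. -/
def secondMoment (x : CirclePhase) : ℂ := ∫ ξ, phasor (x ξ) ^ 2

theorem norm_orderParam_le (x : CirclePhase) : ‖orderParam x‖ ≤ 1 := by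
  simpa [orderParam] using norm_integral_le_of_norm_le_const (μ := (volume : Measure I))
    (ae_of_all _ fun ξ => (norm_phasor (x ξ)).le)

theorem norm_orderParam_sub_le_of_ae (x y : CirclePhase) {C : ℝ}
    (h : ∀ᵐ ξ, ‖phasor (x ξ) - phasor (y ξ)‖ ≤ C) : ‖orderParam x - orderParam y‖ ≤ C :=
  norm_integral_sub_le (integrable_phasor x) (integrable_phasor y) h

theorem norm_secondMoment_sub_le_of_ae (x y : CirclePhase) {C : ℝ}
    (h : ∀ᵐ ξ, ‖phasor (x ξ) - phasor (y ξ)‖ ≤ C) :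
    ‖secondMoment x - secondMoment y‖ ≤ 2 * C := by
  refine norm_integral_sub_le (integrable_phasor_sq x) (integrable_phasor_sq y) ?_
  filter_upwards [h] with ξ hξ
  rw [sq_sub_sq, norm_mul]
  refine mul_le_mul ?_ hξ (norm_nonneg _) zero_le_two
  refine (norm_add_le _ _).trans ?_
  rw [norm_phasor, norm_phasor]; norm_num

theorem ae_norm_phasor_sub_le (x y : CirclePhase) :
    ∀ᵐ ξ, ‖phasor (x ξ) - phasor (y ξ)‖ ≤ ‖x - y‖ := by
  filter_upwards [ae_norm_sub_le x y] with ξ hξ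
  exact (norm_phasor_sub_le _ _).trans hξ

theorem continuous_orderParam : Continuous orderParam :=
  (LipschitzWith.of_dist_le_mul (K := 1) fun x y => by
    simpa [dist_eq_norm] using
      norm_orderParam_sub_le_of_ae x y (ae_norm_phasor_sub_le x y)).continuous

theorem continuous_secondMoment : Continuous secondMoment :=
  (LipschitzWith.of_dist_le_mul (K := 2) fun x y => by
    simpa [dist_eq_norm] using
      norm_secondMoment_sub_le_of_ae x y (ae_norm_phasor_sub_le x y)).continuous

/-! ### The vector field -/

/-- Because `sin (s - t) = Im (e^{is} e^{-it})`, the integral over `z` factors out as the order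
parameter. -/
theorem coeFn_kuramotoField (x : CirclePhase) :
    kuramotoField x =ᵐ[volume] fun ξ => (orderParam x * conj (phasor (x ξ))).im := by
  filter_upwards [(memLp_kuramoto x).coeFn_toLp] with ξ hξ
  rw [kuramotoField, hξ, orderParam, ← integral_mul_const]
  have h := integral_im (𝕜 := ℂ) ((integrable_phasor x).mul_const (conj (phasor (x ξ))))
  simp only [RCLike.im_to_complex] at h
  rw [← h]
  refine integral_congr_ae (ae_of_all _ fun z => ?_)
  simp only [← phasor_sub, phasor_im]

theorem norm_kuramotoField_le (x : CirclePhase) : ‖kuramotoField x‖ ≤ ‖orderParam x‖ := by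
  refine norm_le_of_ae_norm_le _ (norm_nonneg _) ?_
  filter_upwards [coeFn_kuramotoField x] with ξ hξ
  rw [hξ]
  refine (Complex.abs_im_le_norm _).trans ?_
  rw [norm_mul, RCLike.norm_conj, norm_phasor, mul_one]

/-- Keeping the two contributions apart matters: for states with equal order parameters only the
term with the small factor `‖orderParam x‖` survives, which is what the final Gronwall argument
needs. -/
theorem norm_kuramotoField_sub_le_of_ae (x y : CirclePhase) {C : ℝ} (hC : 0 ≤ C)
    (h : ∀ᵐ ξ, ‖phasor (x ξ) - phasor (y ξ)‖ ≤ C) :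
    ‖kuramotoField x - kuramotoField y‖ ≤
      ‖orderParam x - orderParam y‖ + ‖orderParam x‖ * C := by
  refine norm_sub_le_of_ae _ _ (by positivity) ?_
  filter_upwards [coeFn_kuramotoField x, coeFn_kuramotoField y, h] with ξ h1 h2 h3
  rw [h1, h2, ← Complex.sub_im]
  refine (Complex.abs_im_le_norm _).trans ?_
  have e : orderParam x * conj (phasor (x ξ)) - orderParam y * conj (phasor (y ξ))
      = (orderParam x - orderParam y) * conj (phasor (y ξ))
        + orderParam x * conj (phasor (x ξ) - phasor (y ξ)) := by
    rw [map_sub]; ring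
  rw [e]
  refine (norm_add_le _ _).trans ?_
  rw [norm_mul, norm_mul, RCLike.norm_conj, RCLike.norm_conj, norm_phasor, mul_one]
  gcongr

theorem ae_norm_phasor_modTwoPi_sub_le (X Y : RealPhase) :
    ∀ᵐ ξ, ‖phasor (modTwoPi X ξ) - phasor (modTwoPi Y ξ)‖ ≤ ‖X - Y‖ := by
  filter_upwards [ae_norm_phasor_sub_le (modTwoPi X) (modTwoPi Y)] with ξ hξ
  exact hξ.trans (norm_modTwoPi_sub_le X Y)

theorem lipschitzWith_kuramotoField_modTwoPi :
    LipschitzWith 2 fun X : RealPhase => kuramotoField (modTwoPi X) := by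
  refine LipschitzWith.of_dist_le_mul fun X Y => ?_
  rw [dist_eq_norm, dist_eq_norm]
  have h := ae_norm_phasor_modTwoPi_sub_le X Y
  refine (norm_kuramotoField_sub_le_of_ae _ _ (norm_nonneg _) h).trans ?_
  have h1 := norm_orderParam_sub_le_of_ae _ _ h
  have h2 := mul_le_mul_of_nonneg_right (norm_orderParam_le (modTwoPi X)) (norm_nonneg (X - Y))
  push_cast
  linarith

/-- Two lifted solutions which agree at one time of an interval agree on the interval. -/
theorem eqOn_of_hasDerivWithinAt_kuramotoField {J : Set ℝ} (hJ : J.OrdConnected)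
    {X Y : ℝ → RealPhase}
    (hX : ∀ t ∈ J, HasDerivWithinAt X (kuramotoField (modTwoPi (X t))) J t)
    (hY : ∀ t ∈ J, HasDerivWithinAt Y (kuramotoField (modTwoPi (Y t))) J t)
    {t₀ : ℝ} (ht₀ : t₀ ∈ J) (h : X t₀ = Y t₀) : EqOn X Y J := by
  have lip : ∀ t : ℝ, LipschitzOnWith 2
      (fun X : RealPhase => kuramotoField (modTwoPi X)) univ := fun _ =>
    lipschitzWith_kuramotoField_modTwoPi.lipschitzOnWith
  intro t ht
  rcases le_total t₀ t with hle | hle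
  · have hsub : Icc t₀ t ⊆ J := hJ.out ht₀ ht
    have key : ∀ {Z : ℝ → RealPhase},
        (∀ t ∈ J, HasDerivWithinAt Z (kuramotoField (modTwoPi (Z t))) J t) →
        ContinuousOn Z (Icc t₀ t) ∧
        ∀ s ∈ Ico t₀ t, HasDerivWithinAt Z (kuramotoField (modTwoPi (Z s))) (Ici s) s := by
      intro Z hZ
      refine ⟨fun s hs => ((hZ s (hsub hs)).continuousWithinAt).mono hsub, fun s hs => ?_⟩
      refine ((hZ s (hsub (Ico_subset_Icc_self hs))).mono hsub).mono_of_mem_nhdsWithin ?_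
      exact mem_of_superset (Icc_mem_nhdsGE hs.2) (Icc_subset_Icc_left hs.1)
    exact ODE_solution_unique_of_mem_Icc_right (fun s _ => lip s) (key hX).1 (key hX).2
      (fun _ _ => mem_univ _) (key hY).1 (key hY).2 (fun _ _ => mem_univ _) h ⟨hle, le_rfl⟩
  · have hsub : Icc t t₀ ⊆ J := hJ.out ht ht₀
    have key : ∀ {Z : ℝ → RealPhase},
        (∀ t ∈ J, HasDerivWithinAt Z (kuramotoField (modTwoPi (Z t))) J t) →
        ContinuousOn Z (Icc t t₀) ∧
        ∀ s ∈ Ioc t t₀, HasDerivWithinAt Z (kuramotoField (modTwoPi (Z s))) (Iic s) s := by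
      intro Z hZ
      refine ⟨fun s hs => ((hZ s (hsub hs)).continuousWithinAt).mono hsub, fun s hs => ?_⟩
      refine ((hZ s (hsub (Ioc_subset_Icc_self hs))).mono hsub).mono_of_mem_nhdsWithin ?_
      exact mem_of_superset (Icc_mem_nhdsLE hs.1) (Icc_subset_Icc_right hs.2)
    exact ODE_solution_unique_of_mem_Icc_left (fun s _ => lip s) (key hX).1 (key hX).2
      (fun _ _ => mem_univ _) (key hY).1 (key hY).2 (fun _ _ => mem_univ _) h ⟨le_rfl, hle⟩

/-- Two solutions on an interval which agree at one time agree on the interval. -/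
theorem IsSolutionOn.eqOn {J : Set ℝ} (hJ : J.OrdConnected) {x y : ℝ → CirclePhase}
    (hx : IsSolutionOn x J) (hy : IsSolutionOn y J) {t₀ : ℝ} (ht₀ : t₀ ∈ J)
    (h : x t₀ = y t₀) : EqOn x y J := by
  obtain ⟨X, hX⟩ := hx
  obtain ⟨Y, hY⟩ := hy
  -- The two lifts may differ at `t₀` by a function with values in `2πℤ`. Adding it to `Y` for all
  -- times changes neither the circle-valued curve nor the field.
  have hc : modTwoPi (X t₀ - Y t₀) = 0 := by
    rw [modTwoPi_sub, (hX t₀ ht₀).1, (hY t₀ ht₀).1, h, sub_self]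
  have hm : ∀ Z, modTwoPi (Z + (X t₀ - Y t₀)) = modTwoPi Z := fun Z => by
    rw [modTwoPi_add, hc, add_zero]
  have key := eqOn_of_hasDerivWithinAt_kuramotoField hJ (X := X)
    (Y := fun t => Y t + (X t₀ - Y t₀))
    (fun t ht => by rw [(hX t ht).1]; exact (hX t ht).2)
    (fun t ht => by rw [hm, (hY t ht).1]; exact (hY t ht).2.add_const _) ht₀ (by simp)
  intro t ht
  rw [← (hX t ht).1, ← (hY t ht).1, key ht, hm]

/-! ### Evolution of the order parameter -/

theorem norm_phasor_coe_add_sub_sub_le (r h : ℝ) :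
    ‖phasor ((r + h : ℝ) : Real.Angle) - phasor (r : Real.Angle)
      - Complex.I * phasor (r : Real.Angle) * h‖ ≤ 3 * h ^ 2 := by
  have e : phasor ((r + h : ℝ) : Real.Angle) - phasor (r : Real.Angle)
      - Complex.I * phasor (r : Real.Angle) * h
      = phasor (r : Real.Angle) * (Complex.exp (h * Complex.I) - 1 - h * Complex.I) := by
    rw [Real.Angle.coe_add, ← sub_neg_eq_add, phasor_sub, ← Real.Angle.coe_neg, phasor_coe (-h),
      ← Complex.exp_conj]
    simp; ring
  rw [e, norm_mul, norm_phasor, one_mul]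
  -- Small `h`: the Taylor remainder of `exp`. Large `h`: the trivial bound `2 + |h| ≤ 3h²`.
  rcases le_or_gt |h| 1 with h1 | h1
  · have := Complex.norm_exp_sub_one_sub_id_le (x := h * Complex.I) (by simpa using h1)
    refine this.trans ?_
    simp only [norm_mul, Complex.norm_real, Complex.norm_I, mul_one, Real.norm_eq_abs, sq_abs]
    nlinarith [sq_nonneg h]
  · have h2 : ‖Complex.exp (h * Complex.I) - 1 - h * Complex.I‖ ≤ 1 + 1 + |h| := by
      refine (norm_sub_le _ _).trans (add_le_add ((norm_sub_le _ _).trans ?_) ?_)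
      · rw [Complex.norm_exp_ofReal_mul_I]; simp
      · simp
    nlinarith [sq_abs h]

theorem integrable_I_mul_phasor_mul (x : CirclePhase) (h : RealPhase) :
    Integrable fun ξ => Complex.I * phasor (x ξ) * (h ξ : ℂ) := by
  refine Integrable.of_bound (C := ‖h‖) ?_ ?_
  · exact ((integrable_phasor x).aestronglyMeasurable.const_mul _).mul
      (Complex.continuous_ofReal.comp_aestronglyMeasurable (Lp.aestronglyMeasurable h))
  · filter_upwards [ae_norm_coe_le_norm h] with ξ hξ
    simpa [norm_phasor] using hξ

/-- The derivative `h ↦ ∫ i e^{ix} h` of the order parameter. -/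
def orderParamDeriv (x : CirclePhase) : RealPhase →L[ℝ] ℂ :=
  LinearMap.mkContinuous
    { toFun := fun h => ∫ ξ, Complex.I * phasor (x ξ) * (h ξ : ℂ)
      map_add' := fun g h => by
        rw [← integral_add (integrable_I_mul_phasor_mul x g) (integrable_I_mul_phasor_mul x h)]
        refine integral_congr_ae ?_
        filter_upwards [Lp.coeFn_add g h] with ξ hξ
        rw [hξ, Pi.add_apply, Complex.ofReal_add, mul_add]
      map_smul' := fun c h => by
        rw [RingHom.id_apply, ← integral_smul]
        refine integral_congr_ae ?_
        filter_upwards [Lp.coeFn_smul c h] with ξ hξ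
        rw [hξ, Pi.smul_apply, smul_eq_mul, Complex.ofReal_mul, Complex.real_smul]
        ring } 1
    (fun h => by
      have hb : ∀ᵐ ξ, ‖Complex.I * phasor (x ξ) * (h ξ : ℂ)‖ ≤ ‖h‖ := by
        filter_upwards [ae_norm_coe_le_norm h] with ξ hξ
        simpa [norm_phasor] using hξ
      simpa using norm_integral_le_of_norm_le_const hb)

theorem orderParamDeriv_apply (x : CirclePhase) (h : RealPhase) :
    orderParamDeriv x h = ∫ ξ, Complex.I * phasor (x ξ) * (h ξ : ℂ) := rfl

/-- The pointwise remainder `3|h(ξ)|²` is at most `3‖h‖²` because the norm is a supremum;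
integration keeps this bound. -/
theorem hasFDerivAt_orderParam_modTwoPi (X : RealPhase) :
    HasFDerivAt (fun X => orderParam (modTwoPi X)) (orderParamDeriv (modTwoPi X)) X := by
  rw [hasFDerivAt_iff_isLittleO_nhds_zero]
  have hO : (fun h : RealPhase => orderParam (modTwoPi (X + h)) - orderParam (modTwoPi X)
      - orderParamDeriv (modTwoPi X) h) =O[𝓝 0] fun h => ‖h‖ ^ 2 := by
    refine Asymptotics.IsBigO.of_bound 3 (Eventually.of_forall fun h => ?_)
    have hi : Integrable fun ξ => phasor (modTwoPi (X + h) ξ) - phasor (modTwoPi X ξ) :=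
      (integrable_phasor _).sub (integrable_phasor _)
    rw [orderParam, orderParam, ← integral_sub (integrable_phasor _) (integrable_phasor _),
      orderParamDeriv_apply, ← integral_sub hi (integrable_I_mul_phasor_mul _ h)]
    have hb : ∀ᵐ ξ, ‖phasor (modTwoPi (X + h) ξ) - phasor (modTwoPi X ξ)
        - Complex.I * phasor (modTwoPi X ξ) * (h ξ : ℂ)‖ ≤ 3 * ‖h‖ ^ 2 := by
      filter_upwards [coeFn_modTwoPi (X + h), coeFn_modTwoPi X, Lp.coeFn_add X h,
        ae_norm_coe_le_norm h] with ξ h1 h2 h3 h4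
      rw [h1, h2, h3, Pi.add_apply]
      refine (norm_phasor_coe_add_sub_sub_le _ _).trans ?_
      rw [← sq_abs (h ξ), ← Real.norm_eq_abs]
      gcongr
    simpa using norm_integral_le_of_norm_le_const hb
  refine hO.trans_isLittleO ?_
  exact Asymptotics.isLittleO_norm_pow_id one_lt_two

/-- With `p = e^{ix}` and `p p̄ = 1`, the integrand is `i p Im (r p̄) = (r - r̄ p²)/2`. -/
theorem orderParamDeriv_kuramotoField (x : CirclePhase) :
    orderParamDeriv x (kuramotoField x)
      = (orderParam x - conj (orderParam x) * secondMoment x) / 2 := by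
  have h : ∫ ξ, Complex.I * phasor (x ξ) * (kuramotoField x ξ : ℂ)
      = ∫ ξ, (orderParam x / 2 - conj (orderParam x) / 2 * phasor (x ξ) ^ 2) := by
    refine integral_congr_ae ?_
    filter_upwards [coeFn_kuramotoField x] with ξ hξ
    rw [hξ, Complex.im_eq_sub_conj, map_mul, Complex.conj_conj]
    have h1 := phasor_mul_conj (x ξ)
    field_simp
    linear_combination orderParam x * h1
  rw [orderParamDeriv_apply, h, integral_sub (integrable_const _)
    ((integrable_phasor_sq x).const_mul _), integral_const_mul, secondMoment]
  simp
  ring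

theorem hasDerivWithinAt_orderParam {x : ℝ → CirclePhase} {X : ℝ → RealPhase} {J : Set ℝ} {t : ℝ}
    (hx : ∀ s ∈ J, modTwoPi (X s) = x s) (ht : t ∈ J)
    (hX : HasDerivWithinAt X (kuramotoField (x t)) J t) :
    HasDerivWithinAt (fun s => orderParam (x s))
      ((orderParam (x t) - conj (orderParam (x t)) * secondMoment (x t)) / 2) J t := by
  have h := (hasFDerivAt_orderParam_modTwoPi (X t)).comp_hasDerivWithinAt t hX
  rw [hx t ht, orderParamDeriv_kuramotoField] at h
  exact h.congr_of_mem (fun s hs => by simp [hx s hs]) ht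

/-! ### The disc of Ott-Antonsen states -/

/-- The lift `ξ ↦ 2πξ + q` of the twisted state. -/
def twistedLift (q : ℝ) : C(I, ℝ) := ⟨fun ξ => 2 * π * (ξ : ℝ) + q, by fun_prop⟩

/-- The phasor `ξ ↦ e^{i(2πξ + q)}` of the twisted state. -/
def twistedPhasor (q : ℝ) : C(I, ℂ) :=
  ⟨fun ξ => Complex.exp (twistedLift q ξ * Complex.I), by fun_prop⟩

theorem norm_twistedPhasor_apply (q : ℝ) (ξ : I) : ‖twistedPhasor q ξ‖ = 1 :=
  Complex.norm_exp_ofReal_mul_I _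

theorem norm_twistedPhasor_le (q : ℝ) : ‖twistedPhasor q‖ ≤ 1 :=
  (ContinuousMap.norm_le _ zero_le_one).2 fun ξ => (norm_twistedPhasor_apply q ξ).le

theorem twistedPhasor_mul_conj (q : ℝ) (ξ : I) :
    twistedPhasor q ξ * conj (twistedPhasor q ξ) = 1 := by
  rw [Complex.mul_conj, Complex.normSq_eq_norm_sq, norm_twistedPhasor_apply]; simp

/-- The Taylor series of `w ↦ log (1 + w E)` in `C(I, ℂ)`, where `E` is the phasor of the
twisted state. -/
def logSeries (q : ℝ) (w : ℂ) : C(I, ℂ) :=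
  ∑' n : ℕ, ((-1) ^ (n + 1) * w ^ n / n : ℂ) • twistedPhasor q ^ n

theorem norm_logSeries_term_le (q : ℝ) (w : ℂ) (n : ℕ) :
    ‖((-1) ^ (n + 1) * w ^ n / n : ℂ) • twistedPhasor q ^ n‖ ≤ ‖w‖ ^ n := by
  have h1 : ‖twistedPhasor q ^ n‖ ≤ 1 :=
    (norm_pow_le _ _).trans (pow_le_one₀ (norm_nonneg _) (norm_twistedPhasor_le q))
  have h2 : ‖((-1) ^ (n + 1) * w ^ n / n : ℂ)‖ ≤ ‖w‖ ^ n := by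
    rw [norm_div, norm_mul, norm_pow, norm_pow, norm_neg, norm_one, one_pow, one_mul,
      Complex.norm_natCast]
    -- The term `n = 0` vanishes, since division by zero gives zero.
    rcases Nat.eq_zero_or_pos n with rfl | hn
    · simp
    · exact div_le_self (by positivity) (by exact_mod_cast hn)
  rw [norm_smul]
  exact (mul_le_mul h2 h1 (norm_nonneg _) (by positivity)).trans_eq (mul_one _)

theorem norm_mul_twistedPhasor (q : ℝ) (w : ℂ) (ξ : I) : ‖w * twistedPhasor q ξ‖ = ‖w‖ := by
  rw [norm_mul, norm_twistedPhasor_apply, mul_one]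

theorem logSeries_apply (q : ℝ) {w : ℂ} (hw : ‖w‖ < 1) (ξ : I) :
    logSeries q w ξ = Complex.log (1 + w * twistedPhasor q ξ) := by
  have hs : Summable fun n : ℕ => ((-1) ^ (n + 1) * w ^ n / n : ℂ) • twistedPhasor q ^ n :=
    Summable.of_norm_bounded (summable_geometric_of_lt_one (norm_nonneg w) hw)
      (norm_logSeries_term_le q w)
  have h1 := (ContinuousMap.evalCLM ℂ ξ).hasSum hs.hasSum
  have h2 := Complex.hasSum_taylorSeries_log (z := w * twistedPhasor q ξ)
    (by rwa [norm_mul_twistedPhasor])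
  refine h1.unique (h2.congr_fun ?_)
  intro n
  simp [mul_pow]
  ring

/-- The terms are polynomials in `w` dominated by `r ^ n` on `|w| < r < 1`, so the sum is
holomorphic as a map into the Banach space `C(I, ℂ)`. This supplies the smoothness of the chart in
the supremum norm, where pointwise smoothness would not suffice. -/
theorem differentiableOn_logSeries (q : ℝ) :
    DifferentiableOn ℂ (logSeries q) (Metric.ball 0 1) := by
  intro w hw
  obtain ⟨r, hr1, hr2⟩ := exists_between (mem_ball_zero_iff.1 hw)
  have hr0 : 0 ≤ r := (norm_nonneg w).trans hr1.le
  have h : DifferentiableOn ℂ (logSeries q) (Metric.ball 0 r) := by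
    refine Complex.differentiableOn_tsum_of_summable_norm (summable_geometric_of_lt_one hr0 hr2)
      (fun n => ?_) Metric.isOpen_ball fun n z hz => ?_
    · fun_prop
    · refine (norm_logSeries_term_le q z n).trans ?_
      have := (mem_ball_zero_iff.1 hz).le
      gcongr
  exact (h.differentiableAt (Metric.isOpen_ball.mem_nhds
    (mem_ball_zero_iff.2 hr1))).differentiableWithinAt

/-- The map `w ↦ 2πξ + q - 2 arg (1 + w e^{i(2πξ + q)})`, with values in `C(I, ℝ)`. -/
def discLift (q : ℝ) (w : ℂ) : C(I, ℝ) :=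
  twistedLift q - (2 : ℝ) • Complex.imCLM.compLeftContinuous ℝ I (logSeries q w)

theorem discLift_apply (q : ℝ) {w : ℂ} (hw : ‖w‖ < 1) (ξ : I) :
    discLift q w ξ = twistedLift q ξ - 2 * (1 + w * twistedPhasor q ξ).arg := by
  rw [← Complex.log_im, ← logSeries_apply q hw]
  rfl

theorem discLift_zero (q : ℝ) : discLift q 0 = twistedLift q := by
  ext ξ
  rw [discLift_apply q (by simp)]
  simp

theorem contDiffOn_discLift (q : ℝ) :
    ContDiffOn ℝ ((⊤ : ℕ∞) : WithTop ℕ∞) (discLift q) (Metric.ball 0 1) := by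
  have h1 : ContDiffOn ℂ ((⊤ : ℕ∞) : WithTop ℕ∞) (logSeries q) (Metric.ball 0 1) :=
    (differentiableOn_logSeries q).contDiffOn Metric.isOpen_ball
  have h2 := h1.restrict_scalars ℝ
  exact contDiffOn_const.sub (((Complex.imCLM.compLeftContinuous ℝ I).contDiff.comp_contDiffOn
    h2).const_smul _)

/-- The chart of the unstable manifold, as a map into `L^∞(I; ℝ)`. -/
def discChart (q : ℝ) (w : ℂ) : RealPhase :=
  ContinuousMap.toLp ∞ (volume : Measure I) ℝ (discLift q w)

theorem coeFn_discChart (q : ℝ) (w : ℂ) : discChart q w =ᵐ[volume] discLift q w :=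
  ContinuousMap.coeFn_toLp _ _

theorem contDiffOn_discChart (q : ℝ) :
    ContDiffOn ℝ ((⊤ : ℕ∞) : WithTop ℕ∞) (discChart q) (Metric.ball 0 1) :=
  (ContinuousMap.toLp ∞ (volume : Measure I) ℝ : C(I, ℝ) →L[ℝ] RealPhase).contDiff.comp_contDiffOn
    (contDiffOn_discLift q)

theorem modTwoPi_discChart_zero (q : ℝ) : modTwoPi (discChart q 0) = twistedState q := by
  rw [twistedState]
  congr 1
  refine Lp.ext ?_
  filter_upwards [coeFn_discChart q 0, (memLp_twistedState q).coeFn_toLp] with ξ h1 h2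
  rw [h1, h2, discLift_zero]
  rfl

theorem one_add_ne_zero_of_norm_lt_one {z : ℂ} (hz : ‖z‖ < 1) : 1 + z ≠ 0 := fun h => by
  rw [← eq_neg_iff_add_eq_zero] at h
  rw [← norm_neg, ← h, norm_one] at hz
  exact lt_irrefl _ hz

theorem one_add_mem_slitPlane {z : ℂ} (hz : ‖z‖ < 1) : 1 + z ∈ Complex.slitPlane := by
  simpa [add_comm] using Complex.mem_slitPlane_of_norm_lt_one hz

/-- For `u = 1 + wE` one has `e^{-2i arg u} = ū/u`, and `E ū = E + w̄` because `|E| = 1`. -/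
theorem phasor_discLift (q : ℝ) {w : ℂ} (hw : ‖w‖ < 1) (ξ : I) :
    phasor (discLift q w ξ : Real.Angle)
      = (twistedPhasor q ξ + conj w) / (1 + w * twistedPhasor q ξ) := by
  set E := twistedPhasor q ξ with hE
  have hn : ‖w * E‖ < 1 := by rwa [norm_mul_twistedPhasor]
  have h0 : 1 + w * E ≠ 0 := one_add_ne_zero_of_norm_lt_one hn
  have h0' : conj (1 + w * E) ≠ 0 := (map_ne_zero _).2 h0
  have harg : Complex.exp ((1 + w * E).arg * Complex.I) = (1 + w * E) / ‖1 + w * E‖ := by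
    rw [eq_div_iff (by simpa using h0), mul_comm]
    exact Complex.norm_mul_exp_arg_mul_I _
  have hnorm : ((‖1 + w * E‖ : ℝ) : ℂ) ^ 2 = (1 + w * E) * conj (1 + w * E) := by
    rw [Complex.mul_conj, Complex.normSq_eq_norm_sq]; push_cast; rfl
  have h2 : Complex.exp (-(2 * (1 + w * E).arg : ℝ) * Complex.I)
      = conj (1 + w * E) / (1 + w * E) := by
    rw [neg_mul, Complex.exp_neg, Complex.ofReal_mul, mul_assoc, Complex.ofReal_ofNat, two_mul,
      Complex.exp_add, harg, ← sq, div_pow, hnorm]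
    field_simp
  rw [discLift_apply q hw, phasor_coe, Complex.ofReal_sub, sub_eq_add_neg, add_mul,
    Complex.exp_add, h2]
  change E * _ = _
  rw [mul_div_assoc', map_add, map_one, map_mul]
  congr 1
  linear_combination conj w * twistedPhasor_mul_conj q ξ

theorem ae_phasor_discChart (q : ℝ) {w : ℂ} (hw : ‖w‖ < 1) :
    ∀ᵐ ξ, phasor (modTwoPi (discChart q w) ξ)
      = (twistedPhasor q ξ + conj w) / (1 + w * twistedPhasor q ξ) := by
  filter_upwards [coeFn_modTwoPi (discChart q w), coeFn_discChart q w] with ξ h1 h2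
  rw [h1, h2, phasor_discLift q hw]

/-- The mean value property, for functions of the phasor of the twisted state. -/
theorem integral_comp_twistedPhasor (q : ℝ) {g : ℂ → ℂ}
    (hg : DifferentiableOn ℂ g (Metric.closedBall 0 1)) :
    ∫ ξ : I, g (twistedPhasor q ξ) = g 0 := by
  set c : ℂ := Complex.exp (q * Complex.I) with hc
  have hc1 : ‖c‖ = 1 := Complex.norm_exp_ofReal_mul_I q
  -- The shift `q` only rotates the circle; the rotation by `c` fixes the centre, where the mean is
  -- evaluated.
  have hd : DiffContOnCl ℂ (fun z => g (c * z)) (Metric.ball 0 |1|) := by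
    refine DifferentiableOn.diffContOnCl ?_
    rw [abs_one, closure_ball _ one_ne_zero]
    refine hg.comp (by fun_prop) fun z hz => ?_
    rw [mem_closedBall_zero_iff] at hz ⊢
    rwa [norm_mul, hc1, one_mul]
  have h := hd.circleAverage
  rw [Real.circleAverage_def, mul_zero] at h
  rw [← h]
  have h1 : ∫ ξ : I, g (twistedPhasor q ξ)
      = ∫ s in (0 : ℝ)..1, g (c * circleMap 0 1 (2 * π * s)) := by
    have e : (fun ξ : I => g (twistedPhasor q ξ))
        = fun ξ : I => (fun s : ℝ => g (c * circleMap 0 1 (2 * π * s))) ξ := by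
      funext ξ
      simp only [circleMap_zero, hc]
      rw [Complex.ofReal_one, one_mul, ← Complex.exp_add]
      change g (Complex.exp _) = _
      congr 2
      change ((2 * π * (ξ : ℝ) + q : ℝ) : ℂ) * _ = _
      push_cast; ring
    rw [e, intervalIntegral.integral_of_le zero_le_one, ← integral_Icc_eq_integral_Ioc]
    exact integral_subtype (measurableSet_Icc (a := (0 : ℝ)) (b := 1))
      fun s => g (c * circleMap 0 1 (2 * π * s))
  rw [h1, intervalIntegral.integral_comp_mul_left
    (fun s => g (c * circleMap 0 1 s)) Real.two_pi_pos.ne']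
  simp

theorem differentiableOn_mobius {w : ℂ} (hw : ‖w‖ < 1) :
    DifferentiableOn ℂ (fun z => (z + conj w) / (1 + w * z)) (Metric.closedBall 0 1) := by
  refine DifferentiableOn.div (by fun_prop) (by fun_prop) fun z hz => ?_
  refine one_add_ne_zero_of_norm_lt_one ?_
  rw [norm_mul]
  exact (mul_le_of_le_one_right (norm_nonneg _) (mem_closedBall_zero_iff.1 hz)).trans_lt hw

/-- The disc automorphism is holomorphic on the closed disc, so its mean over the circle is its
value `w̄` at the centre. -/
theorem orderParam_discChart (q : ℝ) {w : ℂ} (hw : ‖w‖ < 1) :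
    orderParam (modTwoPi (discChart q w)) = conj w := by
  rw [orderParam, integral_congr_ae (ae_phasor_discChart q hw),
    integral_comp_twistedPhasor q (differentiableOn_mobius hw)]
  simp

theorem secondMoment_discChart (q : ℝ) {w : ℂ} (hw : ‖w‖ < 1) :
    secondMoment (modTwoPi (discChart q w)) = conj w ^ 2 := by
  have h : ∀ᵐ ξ, phasor (modTwoPi (discChart q w) ξ) ^ 2
      = (fun z => ((z + conj w) / (1 + w * z)) ^ 2) (twistedPhasor q ξ) := by
    filter_upwards [ae_phasor_discChart q hw] with ξ hξ
    rw [hξ]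
  rw [secondMoment, integral_congr_ae h,
    integral_comp_twistedPhasor q (g := fun z => ((z + conj w) / (1 + w * z)) ^ 2)
      ((differentiableOn_mobius hw).pow 2)]
  simp

theorem continuousOn_discChart (q : ℝ) : ContinuousOn (discChart q) (Metric.ball 0 1) :=
  (contDiffOn_discChart q).continuousOn

theorem differentiableAt_discChart (q : ℝ) {w : ℂ} (hw : ‖w‖ < 1) :
    DifferentiableAt ℝ (discChart q) w :=
  ((contDiffOn_discChart q).differentiableOn (by simp)).differentiableAt
    (Metric.isOpen_ball.mem_nhds (mem_ball_zero_iff.2 hw))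

theorem fderiv_discChart_ae (q : ℝ) {w : ℂ} (hw : ‖w‖ < 1) (v : ℂ) :
    ∀ᵐ ξ, fderiv ℝ (discChart q) w v ξ
      = -2 * (v * twistedPhasor q ξ / (1 + w * twistedPhasor q ξ)).im := by
  have hd : DifferentiableAt ℝ (discLift q) w :=
    ((contDiffOn_discLift q).differentiableOn (by simp)).differentiableAt
      (Metric.isOpen_ball.mem_nhds (mem_ball_zero_iff.2 hw))
  -- Point evaluation is continuous on `C(I, ℝ)` but undefined on `L^∞`, so the derivative is
  -- computed before passing to classes.
  have h1 : fderiv ℝ (discChart q) w v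
      = ContinuousMap.toLp ∞ (volume : Measure I) ℝ (fderiv ℝ (discLift q) w v) := by
    have := ((ContinuousMap.toLp ∞ (volume : Measure I) ℝ).hasFDerivAt.comp w
      hd.hasFDerivAt).fderiv
    exact congrArg (fun L => L v) this
  have h2 : ∀ ξ, fderiv ℝ (discLift q) w v ξ
      = -2 * (v * twistedPhasor q ξ / (1 + w * twistedPhasor q ξ)).im := by
    intro ξ
    have e1 := (ContinuousMap.evalCLM ℝ ξ).hasFDerivAt.comp w hd.hasFDerivAt
    have hsl : 1 + w * twistedPhasor q ξ ∈ Complex.slitPlane :=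
      one_add_mem_slitPlane (by rwa [norm_mul_twistedPhasor])
    have e2 : HasDerivAt (fun w : ℂ => Complex.log (1 + w * twistedPhasor q ξ))
        (twistedPhasor q ξ / (1 + w * twistedPhasor q ξ)) w := by
      have := ((hasDerivAt_id w).mul_const (twistedPhasor q ξ)).const_add 1
      simpa using this.clog hsl
    have e3 := ((Complex.imCLM.hasFDerivAt.comp w e2.complexToReal_fderiv).const_mul
      (2 : ℝ)).const_sub (twistedLift q ξ)
    have e4 : (fun w => discLift q w ξ) =ᶠ[𝓝 w] fun w =>
        twistedLift q ξ - 2 * (Complex.imCLM ∘ fun w : ℂ =>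
          Complex.log (1 + w * twistedPhasor q ξ)) w := by
      filter_upwards [Metric.isOpen_ball.mem_nhds (mem_ball_zero_iff.2 hw)] with z hz
      rw [discLift_apply q (mem_ball_zero_iff.1 hz), ← Complex.log_im]
      rfl
    have e5 := congrArg (fun L => L v) (e1.unique (e3.congr_of_eventuallyEq e4))
    simp at e5
    rw [e5, mul_div_assoc, Complex.mul_im]
    ring
  rw [h1]
  filter_upwards [ContinuousMap.coeFn_toLp (𝕜 := ℝ) (p := ∞) (volume : Measure I)
    (fderiv ℝ (discLift q) w v)] with ξ hξ
  rw [hξ, h2]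

/-! ### Inverse distribution functions in closed form -/

theorem norm_polar {β : ℝ} (hβ : 0 ≤ β) (α : ℝ) :
    ‖(β * Complex.exp (α * Complex.I) : ℂ)‖ = β := by
  rw [norm_mul, Complex.norm_exp_ofReal_mul_I, mul_one, Complex.norm_real, Real.norm_eq_abs,
    abs_of_nonneg hβ]

theorem one_sub_mem_slitPlane {z : ℂ} (hz : ‖z‖ < 1) : 1 - z ∈ Complex.slitPlane := by
  simpa [sub_eq_add_neg] using one_add_mem_slitPlane (z := -z) (by simpa using hz)

/-- The density is a Poisson kernel, with primitive `φ/(2π) - Im log (1 - w e^{iφ})/π`. The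
principal branch is smooth here, as `1 - u` avoids the cut for `|u| < 1`. -/
theorem circularCDF_eq {β : ℝ} (hβ : β ∈ Ico (0 : ℝ) 1) (α θ : ℝ) :
    circularCDF α β θ = θ / (2 * π) - 1 / π *
      ((1 - β * Complex.exp (α * Complex.I) * Complex.exp (θ * Complex.I)).arg
        - (1 - β * Complex.exp (α * Complex.I)).arg) := by
  set w : ℂ := β * Complex.exp (α * Complex.I) with hw
  have hwn : ‖w‖ < 1 := (norm_polar hβ.1 α).trans_lt hβ.2
  have hder : ∀ φ : ℝ, HasDerivAt (fun φ : ℝ => φ / (2 * π) - 1 / π *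
      (Complex.log (1 - w * Complex.exp (φ * Complex.I))).im) (oaDensity α β φ) φ := by
    intro φ
    set u : ℂ := w * Complex.exp (φ * Complex.I) with hu
    have hun : ‖u‖ < 1 := by rwa [hu, norm_mul, Complex.norm_exp_ofReal_mul_I, mul_one]
    have hu' : u = β * Complex.exp ((α + φ : ℝ) * Complex.I) := by
      rw [hu, hw, mul_assoc, ← Complex.exp_add]; push_cast; ring_nf
    have h1 : HasDerivAt (fun φ : ℝ => 1 - w * Complex.exp (φ * Complex.I))
        (-(u * Complex.I)) φ := by
      have h := ((((hasDerivAt_id (φ : ℂ)).mul_const Complex.I).cexp.const_mul w).const_sub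
        1).comp_ofReal
      simpa [hu, mul_assoc] using h
    have h2 := h1.clog_real (one_sub_mem_slitPlane hun)
    have h3 := Complex.imCLM.hasFDerivAt.comp_hasDerivAt φ h2
    have h4 := ((hasDerivAt_id φ).div_const (2 * π)).sub (h3.const_mul (1 / π))
    refine h4.congr_deriv ?_
    have hre : u.re = β * Real.cos (α + φ) := by
      rw [hu', Complex.re_ofReal_mul, Complex.exp_ofReal_mul_I_re]
    have him : u.im = β * Real.sin (α + φ) := by
      rw [hu', Complex.im_ofReal_mul, Complex.exp_ofReal_mul_I_im]
    have hden := oaDensity_den_pos hβ α φ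
    have hsc := Real.sin_sq_add_cos_sq (α + φ)
    have hns : Complex.normSq (1 - u) = 1 - 2 * β * Real.cos (α + φ) + β ^ 2 := by
      rw [Complex.normSq_apply]
      simp only [Complex.sub_re, Complex.sub_im, Complex.one_re, Complex.one_im, hre, him]
      linear_combination β ^ 2 * hsc
    clear_value u
    rw [Complex.imCLM_apply, Complex.div_im, ← hu, hns, oaDensity]
    simp only [Complex.sub_re, Complex.sub_im, Complex.one_re, Complex.one_im, Complex.neg_re,
      Complex.neg_im, Complex.mul_re, Complex.mul_im, Complex.I_re, Complex.I_im, hre, him]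
    have hpi := Real.pi_ne_zero
    have hden' := hden.ne'
    field_simp
    linear_combination (-2 * β ^ 2) * hsc
  rw [circularCDF, intervalIntegral.integral_eq_sub_of_hasDerivAt (fun φ _ => hder φ)
    ((continuous_oaDensity hβ α).intervalIntegrable _ _)]
  simp only [Complex.log_im]
  simp
  ring

theorem arg_eq_arctan_of_re_pos {z : ℂ} (hz : 0 < z.re) : z.arg = Real.arctan (z.im / z.re) := by
  rw [← Complex.tan_arg, Real.arctan_tan]
  · exact neg_lt_of_abs_lt (Complex.abs_arg_lt_pi_div_two_iff.2 (Or.inl hz))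
  · exact lt_of_abs_lt (Complex.abs_arg_lt_pi_div_two_iff.2 (Or.inl hz))

theorem phaseShift_eq {β : ℝ} (hβ : β ∈ Ico (0 : ℝ) 1) (α : ℝ) :
    phaseShift α β = 1 / π * (1 - β * Complex.exp (α * Complex.I)).arg := by
  have hre : (1 - β * Complex.exp (α * Complex.I)).re = 1 - β * Real.cos α := by
    rw [Complex.sub_re, Complex.re_ofReal_mul, Complex.exp_ofReal_mul_I_re, Complex.one_re]
  have him : (1 - β * Complex.exp (α * Complex.I)).im = -(β * Real.sin α) := by
    rw [Complex.sub_im, Complex.im_ofReal_mul, Complex.exp_ofReal_mul_I_im, Complex.one_im,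
      zero_sub]
  have hpos : 0 < 1 - β * Real.cos α := by
    have := mul_le_of_le_one_right hβ.1 (Real.cos_le_one α)
    linarith [hβ.2]
  rw [arg_eq_arctan_of_re_pos (by rwa [hre]), hre, him, neg_div, Real.arctan_neg, phaseShift]
  ring

/-- For `|w| < 1`, `1 - w(z + w̄)/(1 + wz) = (1 - |w|²)/(1 + wz)` is a positive multiple of `(1 +
wz)⁻¹`. -/
theorem arg_one_sub_mul_mobius {w z : ℂ} (hw : ‖w‖ < 1) (hz : ‖z‖ = 1) :
    (1 - w * ((z + conj w) / (1 + w * z))).arg = -(1 + w * z).arg := by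
  have hn : ‖w * z‖ < 1 := by rwa [norm_mul, hz, mul_one]
  have h0 : 1 + w * z ≠ 0 := one_add_ne_zero_of_norm_lt_one hn
  have h1 : 1 - w * ((z + conj w) / (1 + w * z)) = ((1 - ‖w‖ ^ 2 : ℝ) : ℂ) * (1 + w * z)⁻¹ := by
    have := Complex.mul_conj w
    rw [Complex.normSq_eq_norm_sq] at this
    field_simp
    push_cast at this ⊢
    linear_combination -this
  have h2 : 0 < 1 - ‖w‖ ^ 2 := by nlinarith [norm_nonneg w]
  rw [h1, Complex.arg_real_mul _ h2, Complex.arg_inv,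
    if_neg (Complex.slitPlane_arg_ne_pi (one_add_mem_slitPlane hn))]

/-- Apply the injective `F` to the right-hand side: the phase shift is exactly the integration
constant of `F`, and the two terms with `arg (1 + wE)` cancel. -/
theorem circularCDFInv_eq_discLift (q : ℝ) {β : ℝ} (hβ : β ∈ Ico (0 : ℝ) 1) (α : ℝ) (ξ : I) :
    circularCDFInv α β ((ξ : ℝ) + phaseShift α β + q / (2 * π))
      = discLift q (β * Complex.exp (α * Complex.I)) ξ := by
  have hw : ‖(β * Complex.exp (α * Complex.I) : ℂ)‖ < 1 := (norm_polar hβ.1 α).trans_lt hβ.2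
  have h : circularCDF α β (discLift q (β * Complex.exp (α * Complex.I)) ξ)
      = (ξ : ℝ) + phaseShift α β + q / (2 * π) := by
    rw [circularCDF_eq hβ, phaseShift_eq hβ, ← phasor_coe (discLift q _ ξ), phasor_discLift q hw,
      arg_one_sub_mul_mobius hw (norm_twistedPhasor_apply q ξ), discLift_apply q hw]
    change (2 * π * (ξ : ℝ) + q - _) / _ - _ = _
    have := Real.pi_ne_zero
    field_simp
    ring
  rw [← h]
  exact Function.leftInverse_invFun (bijective_circularCDF hβ α).injective _

theorem modTwoPi_discChart_polar (q : ℝ) {β : ℝ} (hβ : β ∈ Ico (0 : ℝ) 1) (α : ℝ) :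
    modTwoPi (discChart q (β * Complex.exp (α * Complex.I))) =ᵐ[volume] oaState q α β := by
  filter_upwards [coeFn_modTwoPi (discChart q (β * Complex.exp (α * Complex.I))),
    coeFn_discChart q (β * Complex.exp (α * Complex.I))] with ξ h1 h2
  rw [h1, h2, oaState, circularCDFInv_eq_discLift q hβ]

theorem ae_eq_oaState_iff (q : ℝ) {β : ℝ} (hβ : β ∈ Ico (0 : ℝ) 1) (α : ℝ) (x : CirclePhase) :
    x =ᵐ[volume] oaState q α β ↔
      x = modTwoPi (discChart q (β * Complex.exp (α * Complex.I))) :=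
  ⟨fun h => Lp.ext (h.trans (modTwoPi_discChart_polar q hβ α).symm),
    fun h => h ▸ modTwoPi_discChart_polar q hβ α⟩

/-! ### The vector field along the disc -/

/-- The invariance of the disc: `w(E + w̄)/(1 + wE) = w(1 - |w|²)E/(1 + wE) + |w|²`, and the real
constant drops out of the imaginary part. -/
theorem fderiv_discChart_radial (q : ℝ) {w : ℂ} (hw : ‖w‖ < 1) :
    fderiv ℝ (discChart q) w (w * (1 - ‖w‖ ^ 2) / 2)
      = kuramotoField (modTwoPi (discChart q w)) := by
  refine Lp.ext ?_
  filter_upwards [fderiv_discChart_ae q hw (w * (1 - ‖w‖ ^ 2) / 2), ae_phasor_discChart q hw,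
    coeFn_kuramotoField (modTwoPi (discChart q w))] with ξ h1 h2 h3
  rw [h1, h3, h2, orderParam_discChart q hw, ← map_mul, Complex.conj_im]
  set E := twistedPhasor q ξ
  have h0 : 1 + w * E ≠ 0 := one_add_ne_zero_of_norm_lt_one (by rwa [norm_mul_twistedPhasor])
  have hn : w * conj w = ((‖w‖ ^ 2 : ℝ) : ℂ) := by
    rw [Complex.mul_conj, Complex.normSq_eq_norm_sq]
  have e : w * ((E + conj w) / (1 + w * E))
      = 2 * (w * (1 - ‖w‖ ^ 2) / 2 * E / (1 + w * E)) + ((‖w‖ ^ 2 : ℝ) : ℂ) := by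
    field_simp
    push_cast at hn ⊢
    linear_combination hn
  rw [e, Complex.add_im, Complex.ofReal_im, add_zero]
  simp

theorem norm_fderiv_discChart_le (q : ℝ) {w : ℂ} (hw : ‖w‖ ≤ 1 / 2) (v : ℂ) :
    ‖fderiv ℝ (discChart q) w v‖ ≤ 4 * ‖v‖ := by
  refine norm_le_of_ae_norm_le _ (by positivity) ?_
  filter_upwards [fderiv_discChart_ae q (by linarith) v] with ξ hξ
  have h1 : 1 / 2 ≤ ‖1 + w * twistedPhasor q ξ‖ := by
    have := norm_sub_norm_le (1 : ℂ) (-(w * twistedPhasor q ξ))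
    rw [norm_one, norm_neg, norm_mul_twistedPhasor, sub_neg_eq_add] at this
    linarith
  rw [hξ, norm_mul, norm_neg, Real.norm_ofNat, Real.norm_eq_abs]
  refine (mul_le_mul_of_nonneg_left (Complex.abs_im_le_norm _) zero_le_two).trans ?_
  rw [norm_div, norm_mul_twistedPhasor, mul_div_assoc', div_le_iff₀ (by linarith)]
  nlinarith [norm_nonneg v]

theorem norm_discChart_sub_zero_le (q : ℝ) {w : ℂ} (hw : ‖w‖ < 1) :
    ‖discChart q w - discChart q 0‖ ≤ 4 * π * ‖w‖ := by
  refine norm_sub_le_of_ae _ _ (by positivity) ?_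
  filter_upwards [coeFn_discChart q w, coeFn_discChart q 0] with ξ h1 h2
  rw [h1, h2, discLift_zero, discLift_apply q hw, sub_sub_cancel_left, norm_neg, norm_mul,
    Real.norm_ofNat, Real.norm_eq_abs]
  have hn := norm_mul_twistedPhasor q w ξ
  have hpi := Real.pi_gt_three
  have hpos := norm_nonneg w
  -- Near `0` the bound on `log (1 + z)` applies; otherwise `2|arg| ≤ 2π < 4π‖w‖`.
  rcases le_or_gt ‖w‖ (1 / 2) with h | h
  · have hl := Complex.norm_log_one_add_le (z := w * twistedPhasor q ξ) (by rwa [hn])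
    have ha := Complex.abs_im_le_norm (Complex.log (1 + w * twistedPhasor q ξ))
    rw [Complex.log_im] at ha
    have hi : (1 - ‖w‖)⁻¹ ≤ 2 := by
      rw [inv_le_comm₀ (by linarith) two_pos]; linarith
    rw [hn] at hl
    have h3 : ‖w‖ ^ 2 * (1 - ‖w‖)⁻¹ ≤ ‖w‖ ^ 2 * 2 := by gcongr
    nlinarith
  · have := Complex.abs_arg_le_pi (1 + w * twistedPhasor q ξ)
    nlinarith

/-- Order parameter after chart is complex conjugation, so by the chain rule the derivative has a
left inverse. -/
theorem injective_fderiv_discChart (q : ℝ) {w : ℂ} (hw : ‖w‖ < 1) :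
    Function.Injective (fderiv ℝ (discChart q) w) := by
  have h1 := (hasFDerivAt_orderParam_modTwoPi (discChart q w)).comp w
    (differentiableAt_discChart q hw).hasFDerivAt
  have h2 : HasFDerivAt ((fun X => orderParam (modTwoPi X)) ∘ discChart q)
      (Complex.conjCLE : ℂ →L[ℝ] ℂ) w := by
    refine Complex.conjCLE.hasFDerivAt.congr_of_eventuallyEq ?_
    filter_upwards [Metric.isOpen_ball.mem_nhds (mem_ball_zero_iff.2 hw)] with z hz
    exact orderParam_discChart q (mem_ball_zero_iff.1 hz)
  have h3 := h1.unique h2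
  refine Function.Injective.of_comp (f := orderParamDeriv (modTwoPi (discChart q w))) ?_
  intro a b hab
  have e : ∀ z, orderParamDeriv (modTwoPi (discChart q w)) (fderiv ℝ (discChart q) w z)
      = conj z := fun z => congrArg (fun L => L z) h3
  simp only [Function.comp_apply, e] at hab
  exact star_injective hab

theorem isEmbedding_modTwoPi_discChart (q : ℝ) :
    IsEmbedding fun w : Metric.ball (0 : ℂ) 1 => modTwoPi (discChart q w) := by
  have hc : Continuous fun w : Metric.ball (0 : ℂ) 1 => modTwoPi (discChart q w) :=
    continuous_modTwoPi.comp (continuousOn_iff_continuous_domRestrict.1 (continuousOn_discChart q))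
  have hl : Continuous fun x : CirclePhase => conj (orderParam x) :=
    Complex.continuous_conj.comp continuous_orderParam
  have he : IsEmbedding ((fun x : CirclePhase => conj (orderParam x)) ∘
      fun w : Metric.ball (0 : ℂ) 1 => modTwoPi (discChart q w)) := by
    convert IsEmbedding.subtypeVal (p := (· ∈ Metric.ball (0 : ℂ) 1)) using 1
    funext w
    simp [orderParam_discChart q (mem_ball_zero_iff.1 w.2)]
  exact he.of_comp hc hl

/-- The disc `{Θ_w : |w| < 1}` of Ott-Antonsen states. -/
def oaDisc (q : ℝ) : Set CirclePhase := (fun w => modTwoPi (discChart q w)) '' Metric.ball 0 1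

theorem mem_oaDisc_iff (q : ℝ) (x : CirclePhase) :
    x ∈ oaDisc q ↔ ∃ β ∈ Ico (0 : ℝ) 1, ∃ α ∈ Icc (-π) π, x =ᵐ[volume] oaState q α β := by
  constructor
  · rintro ⟨w, hw, rfl⟩
    have hβ : ‖w‖ ∈ Ico (0 : ℝ) 1 := ⟨norm_nonneg w, mem_ball_zero_iff.1 hw⟩
    refine ⟨‖w‖, hβ, w.arg, ⟨(Complex.neg_pi_lt_arg w).le, Complex.arg_le_pi w⟩, ?_⟩
    rw [ae_eq_oaState_iff q hβ, Complex.norm_mul_exp_arg_mul_I]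
  · rintro ⟨β, hβ, α, -, h⟩
    refine ⟨β * Complex.exp (α * Complex.I), ?_, ((ae_eq_oaState_iff q hβ α x).1 h).symm⟩
    rw [mem_ball_zero_iff, norm_polar hβ.1]
    exact hβ.2

theorem isSmoothDisc_oaDisc (q : ℝ) : IsSmoothDisc (oaDisc q) (discChart q) where
  smooth := contDiffOn_discChart q
  immersive _ hw := injective_fderiv_discChart q (mem_ball_zero_iff.1 hw)
  embedding := isEmbedding_modTwoPi_discChart q
  image_eq := rfl

/-! ### Dynamics on the disc -/

theorem isSolutionOn_of_hasDerivWithinAt (q : ℝ) {J : Set ℝ} {w : ℝ → ℂ} {x : ℝ → CirclePhase}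
    (hx : ∀ t ∈ J, ‖w t‖ < 1 ∧ x t = modTwoPi (discChart q (w t)))
    (hw : ∀ t ∈ J, HasDerivWithinAt w (w t * (1 - ‖w t‖ ^ 2) / 2) J t) : IsSolutionOn x J := by
  refine ⟨fun t => discChart q (w t), fun t ht => ⟨(hx t ht).2.symm, ?_⟩⟩
  have h := (differentiableAt_discChart q (hx t ht).1).hasFDerivAt.comp_hasDerivWithinAt t
    (hw t ht)
  rwa [fderiv_discChart_radial q (hx t ht).1, ← (hx t ht).2] at h

/-- The solution of `β' = β (1 - β²) / 2` with `β(0) = b / √(1 + b²)`. -/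
def radialSolution (b t : ℝ) : ℝ := b * Real.exp (t / 2) / √(1 + b ^ 2 * Real.exp t)

theorem radialSolution_sq (b t : ℝ) :
    radialSolution b t ^ 2 = b ^ 2 * Real.exp t / (1 + b ^ 2 * Real.exp t) := by
  rw [radialSolution, div_pow, mul_pow, Real.sq_sqrt (by positivity), sq (Real.exp _),
    ← Real.exp_add, add_halves]

theorem radialSolution_mem {b : ℝ} (hb : 0 ≤ b) (t : ℝ) : radialSolution b t ∈ Ico (0 : ℝ) 1 := by
  refine ⟨by unfold radialSolution; positivity, ?_⟩
  refine lt_of_pow_lt_pow_left₀ 2 zero_le_one ?_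
  rw [radialSolution_sq, one_pow, div_lt_one (by positivity)]
  linarith

theorem radialSolution_le {b : ℝ} (hb : 0 ≤ b) (t : ℝ) :
    radialSolution b t ≤ b * Real.exp (t / 2) := by
  refine div_le_self (by positivity) (Real.one_le_sqrt.2 ?_)
  have : 0 ≤ b ^ 2 * Real.exp t := by positivity
  linarith

theorem hasDerivAt_radialSolution (b t : ℝ) :
    HasDerivAt (radialSolution b)
      (radialSolution b t * (1 - radialSolution b t ^ 2) / 2) t := by
  have hpos : 0 < 1 + b ^ 2 * Real.exp t := by positivity
  have h1 : HasDerivAt (fun t => b * Real.exp (t / 2)) (b * (Real.exp (t / 2) * (1 / 2))) t :=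
    (((hasDerivAt_id t).div_const 2).exp).const_mul b
  have h2 : HasDerivAt (fun t => √(1 + b ^ 2 * Real.exp t))
      (b ^ 2 * Real.exp t / (2 * √(1 + b ^ 2 * Real.exp t))) t :=
    (((Real.hasDerivAt_exp t).const_mul (b ^ 2)).const_add 1).sqrt hpos.ne'
  have hs : √(1 + b ^ 2 * Real.exp t) ≠ 0 := (Real.sqrt_pos.2 hpos).ne'
  refine (h1.div h2 hs).congr_deriv ?_
  rw [radialSolution_sq, radialSolution]
  have hsq : √(1 + b ^ 2 * Real.exp t) ^ 2 = 1 + b ^ 2 * Real.exp t := Real.sq_sqrt hpos.le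
  set s := √(1 + b ^ 2 * Real.exp t)
  have he : b ^ 2 * Real.exp t = s ^ 2 - 1 := by linarith
  rw [← hsq, he]
  field_simp

theorem exists_radialSolution_eq {β₀ : ℝ} (h : β₀ ∈ Ico (0 : ℝ) 1) (t₀ : ℝ) :
    ∃ b : ℝ, 0 ≤ b ∧ radialSolution b t₀ = β₀ := by
  have hpos : 0 < 1 - β₀ ^ 2 := by nlinarith [h.1, h.2]
  -- This solves `β₀² = b²e^{t₀}/(1 + b²e^{t₀})` for `b`.
  refine ⟨β₀ / √(1 - β₀ ^ 2) * Real.exp (-(t₀ / 2)), ?_, ?_⟩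
  · have := h.1
    positivity
  · have hb : 0 ≤ β₀ / √(1 - β₀ ^ 2) * Real.exp (-(t₀ / 2)) := by
      have := h.1
      positivity
    rw [← pow_left_inj₀ (radialSolution_mem hb t₀).1 h.1 two_ne_zero, radialSolution_sq]
    have e : (β₀ / √(1 - β₀ ^ 2) * Real.exp (-(t₀ / 2))) ^ 2 * Real.exp t₀
        = β₀ ^ 2 / (1 - β₀ ^ 2) := by
      rw [mul_pow, div_pow, Real.sq_sqrt hpos.le, mul_assoc, sq (Real.exp _), ← Real.exp_add,
        ← Real.exp_add]
      ring_nf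
      simp
    rw [e]
    have := hpos.ne'
    field_simp
    ring

theorem isSolutionOn_radialSolution (q α : ℝ) {b : ℝ} (hb : 0 ≤ b) (J : Set ℝ) :
    IsSolutionOn (fun t => modTwoPi (discChart q (radialSolution b t
      * Complex.exp (α * Complex.I)))) J := by
  have hn := fun t => norm_polar (radialSolution_mem hb t).1 α
  refine isSolutionOn_of_hasDerivWithinAt q
    (w := fun t => radialSolution b t * Complex.exp (α * Complex.I))
    (fun t _ => ⟨(hn t).trans_lt (radialSolution_mem hb t).2, rfl⟩) fun t _ => ?_
  refine (((hasDerivAt_radialSolution b t).ofReal_comp.mul_const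
    (Complex.exp (α * Complex.I))).congr_deriv ?_).hasDerivWithinAt
  rw [hn]
  push_cast
  ring

/-- A solution which meets the disc is a radial one. -/
theorem IsSolutionOn.exists_radialSolution (q : ℝ) {J : Set ℝ} (hJ : J.OrdConnected)
    {x : ℝ → CirclePhase} (hx : IsSolutionOn x J) {t₀ : ℝ} (ht₀ : t₀ ∈ J)
    (h : x t₀ ∈ oaDisc q) :
    ∃ α ∈ Icc (-π) π, ∃ b : ℝ, 0 ≤ b ∧ ∀ t ∈ J,
      x t = modTwoPi (discChart q (radialSolution b t * Complex.exp (α * Complex.I))) := by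
  obtain ⟨β₀, hβ₀, α, hα, hxt⟩ := (mem_oaDisc_iff q _).1 h
  obtain ⟨b, hb, hb₀⟩ := exists_radialSolution_eq hβ₀ t₀
  refine ⟨α, hα, b, hb, fun t ht => ?_⟩
  refine hx.eqOn hJ (isSolutionOn_radialSolution q α hb J) ht₀ ?_ ht
  rw [(ae_eq_oaState_iff q hβ₀ α _).1 hxt, hb₀]

theorem polar_radialSolution_mem_ball {b : ℝ} (hb : 0 ≤ b) (α t : ℝ) :
    ‖(radialSolution b t * Complex.exp (α * Complex.I) : ℂ)‖ < 1 :=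
  (norm_polar (radialSolution_mem hb t).1 α).trans_lt (radialSolution_mem hb t).2

theorem dist_radialSolution_le (q α : ℝ) {b : ℝ} (hb : 0 ≤ b) (t : ℝ) :
    dist (modTwoPi (discChart q (radialSolution b t * Complex.exp (α * Complex.I))))
      (twistedState q) ≤ 4 * π * b * Real.exp (t / 2) := by
  rw [← modTwoPi_discChart_zero, dist_eq_norm]
  refine (norm_modTwoPi_sub_le _ _).trans ?_
  refine (norm_discChart_sub_zero_le q (polar_radialSolution_mem_ball hb α t)).trans ?_
  rw [norm_polar (radialSolution_mem hb t).1, mul_assoc (4 * π)]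
  exact mul_le_mul_of_nonneg_left (radialSolution_le hb t) (by positivity)

theorem oaDisc_subset_unstableManifold (q : ℝ) :
    oaDisc q ⊆ unstableManifold (twistedState q) := by
  intro x₀ hx₀
  obtain ⟨β₀, hβ₀, α, hα, hxt⟩ := (mem_oaDisc_iff q _).1 hx₀
  obtain ⟨b, hb, hb₀⟩ := exists_radialSolution_eq hβ₀ 0
  refine ⟨_, isSolutionOn_radialSolution q α hb (Iic 0), ?_, ?_⟩
  · rw [(ae_eq_oaState_iff q hβ₀ α _).1 hxt, hb₀]
  · rw [tendsto_iff_dist_tendsto_zero]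
    refine squeeze_zero (fun _ => dist_nonneg) (dist_radialSolution_le q α hb) ?_
    have h : Tendsto (fun t : ℝ => Real.exp (t / 2)) atBot (𝓝 0) :=
      Real.tendsto_exp_atBot.comp (tendsto_id.atBot_div_const two_pos)
    simpa using h.const_mul (4 * π * b)

/-! ### The parameter equations -/

theorem isSolutionOn_of_solvesParameterODE (q : ℝ) {J : Set ℝ} {α β : ℝ → ℝ}
    {x : ℝ → CirclePhase} (hα : DifferentiableOn ℝ α J)
    (hx : ∀ t ∈ J, β t ∈ Ico (0 : ℝ) 1 ∧ x t =ᵐ[volume] oaState q (α t) (β t))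
    (h : SolvesParameterODE α β J) : IsSolutionOn x J := by
  refine isSolutionOn_of_hasDerivWithinAt q (w := fun t => β t * Complex.exp (α t * Complex.I))
    (fun t ht => ⟨(norm_polar (hx t ht).1.1 _).trans_lt (hx t ht).1.2,
      (ae_eq_oaState_iff q (hx t ht).1 _ _).1 (hx t ht).2⟩) fun t ht => ?_
  -- Only the product `β α'` enters `w'`, so any derivative of the angle will do where `β` vanishes.
  obtain ⟨α', hα', h0⟩ : ∃ α', HasDerivWithinAt α α' J t ∧ β t * α' = 0 := by
    by_cases h0 : β t = 0
    · exact ⟨_, (hα t ht).hasDerivWithinAt, by rw [h0, zero_mul]⟩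
    · exact ⟨0, (h t ht).2 h0, mul_zero _⟩
  have h1 := (h t ht).1.ofReal_comp.mul (hα'.ofReal_comp.mul_const Complex.I).cexp
  refine h1.congr_deriv ?_
  rw [norm_polar (hx t ht).1.1]
  have h2 : (β t : ℂ) * α' = 0 := by exact_mod_cast h0
  push_cast
  linear_combination Complex.exp (α t * Complex.I) * Complex.I * h2

/-- No regularity of `w` is assumed: it is the conjugate order parameter of `x`, hence
differentiable, and its equation closes because `m = w̄²`. -/
theorem IsSolutionOn.hasDerivWithinAt_of_eq_discChart (q : ℝ) {J : Set ℝ} {x : ℝ → CirclePhase}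
    (hx : IsSolutionOn x J) {w : ℝ → ℂ}
    (hw : ∀ t ∈ J, ‖w t‖ < 1 ∧ x t = modTwoPi (discChart q (w t))) {t : ℝ} (ht : t ∈ J) :
    HasDerivWithinAt w (w t * (1 - ‖w t‖ ^ 2) / 2) J t := by
  obtain ⟨X, hX⟩ := hx
  have h := hasDerivWithinAt_orderParam (fun s hs => (hX s hs).1) ht (hX t ht).2
  have hr : ∀ s ∈ J, orderParam (x s) = conj (w s) := fun s hs => by
    rw [(hw s hs).2, orderParam_discChart q (hw s hs).1]
  have h2 := Complex.conjCLE.hasFDerivAt.comp_hasDerivWithinAt t h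
  refine (h2.congr_of_mem (fun s hs => by simp [hr s hs]) ht).congr_deriv ?_
  rw [hr t ht, (hw t ht).2, secondMoment_discChart q (hw t ht).1]
  have hn : w t * conj (w t) = ((‖w t‖ ^ 2 : ℝ) : ℂ) := by
    rw [Complex.mul_conj, Complex.normSq_eq_norm_sq]
  push_cast at hn
  rw [← hn]
  have h2 : conj (2 : ℂ) = 2 := Complex.conj_ofNat 2
  simp [h2]
  ring

theorem solvesParameterODE_of_isSolutionOn (q : ℝ) {J : Set ℝ} (hJ : J.OrdConnected)
    {α β : ℝ → ℝ} {x : ℝ → CirclePhase} (hα : DifferentiableOn ℝ α J)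
    (hβ : DifferentiableOn ℝ β J)
    (hx : ∀ t ∈ J, β t ∈ Ico (0 : ℝ) 1 ∧ x t =ᵐ[volume] oaState q (α t) (β t))
    (h : IsSolutionOn x J) : SolvesParameterODE α β J := by
  intro t ht
  -- Derivatives within a one-point interval are not unique, but there every value is one.
  rcases J.subsingleton_or_nontrivial with hs | hs
  · exact ⟨HasFDerivWithinAt.of_subsingleton hs, fun _ => HasFDerivWithinAt.of_subsingleton hs⟩
  have hu : UniqueDiffWithinAt ℝ J t := by
    refine uniqueDiffWithinAt_convex hJ.convex ?_ (subset_closure ht)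
    exact hJ.convex.nontrivial_iff_nonempty_interior.1 hs
  have h1 := (hβ t ht).hasDerivWithinAt.ofReal_comp.mul
    ((hα t ht).hasDerivWithinAt.ofReal_comp.mul_const Complex.I).cexp
  have h2 := h.hasDerivWithinAt_of_eq_discChart q
    (w := fun t => β t * Complex.exp (α t * Complex.I))
    (fun t ht => ⟨(norm_polar (hx t ht).1.1 _).trans_lt (hx t ht).1.2,
      (ae_eq_oaState_iff q (hx t ht).1 _ _).1 (hx t ht).2⟩) ht
  have h3 := hu.eq_deriv _ h1 h2
  rw [norm_polar (hx t ht).1.1] at h3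
  -- Cancelling `e^{iα}` separates the radial equation (real part) from `β α' = 0` (imaginary part).
  have h4 : ((derivWithin β J t : ℝ) : ℂ) + ((β t * derivWithin α J t : ℝ) : ℂ) * Complex.I
      = ((β t * (1 - β t ^ 2) / 2 : ℝ) : ℂ) := by
    refine mul_right_cancel₀ (Complex.exp_ne_zero (α t * Complex.I)) ?_
    push_cast
    linear_combination h3
  have hre := congrArg Complex.re h4
  have him := congrArg Complex.im h4
  rw [Complex.add_re, Complex.ofReal_re, Complex.re_ofReal_mul, Complex.I_re, mul_zero, add_zero,
    Complex.ofReal_re] at hre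
  rw [Complex.add_im, Complex.ofReal_im, Complex.im_ofReal_mul, Complex.I_im, mul_one, zero_add,
    Complex.ofReal_im] at him
  refine ⟨(hβ t ht).hasDerivWithinAt.congr_deriv hre, fun h0 =>
    (hα t ht).hasDerivWithinAt.congr_deriv ((mul_eq_zero.1 him).resolve_left h0)⟩

/-! ### Backward solutions near the twisted state -/

/-- Backward exponential decay of a curve in `ℂ` satisfying `r' = (r - r̄ m) / 2` with
`‖m‖ ≤ 1/2`. -/
theorem norm_le_exp_of_hasDerivAt {r m : ℝ → ℂ} {T : ℝ}
    (hc : ContinuousOn r (Iic T)) (hr : ∀ t < T, HasDerivAt r ((r t - conj (r t) * m t) / 2) t)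
    (hm : ∀ t ≤ T, ‖m t‖ ≤ 1 / 2) (h1 : ‖r T‖ ≤ 1) {t : ℝ} (ht : t ≤ T) :
    ‖r t‖ ≤ Real.exp ((t - T) / 4) := by
  have hd : ∀ t < T, HasDerivAt (fun t => ‖r t‖ ^ 2 * Real.exp (-(t / 2)))
      (2 * inner ℝ (r t) ((r t - conj (r t) * m t) / 2) * Real.exp (-(t / 2))
        + ‖r t‖ ^ 2 * (Real.exp (-(t / 2)) * -(1 / 2))) t := fun t ht =>
    (hr t ht).norm_sq.mul (((hasDerivAt_id t).div_const 2).neg.exp)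
  -- The derivative of `|r|²` is `|r|² - ⟨r, r̄ m⟩ ≥ |r|²/2`, so `|r|² e^{-t/2}` is nondecreasing.
  have hin : ∀ t ≤ T, ‖r t‖ ^ 2 / 2 ≤ 2 * inner ℝ (r t) ((r t - conj (r t) * m t) / 2) := by
    intro t ht
    have h2 : inner ℝ (r t) (conj (r t) * m t) ≤ ‖r t‖ ^ 2 / 2 := by
      refine (real_inner_le_norm _ _).trans ?_
      rw [norm_mul, RCLike.norm_conj]
      nlinarith [mul_le_mul_of_nonneg_left (hm t ht) (sq_nonneg ‖r t‖)]
    have h3 : (r t - conj (r t) * m t) / 2 = (1 / 2 : ℝ) • (r t - conj (r t) * m t) := by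
      rw [Complex.real_smul]; push_cast; ring
    rw [h3, inner_smul_right, inner_sub_right, real_inner_self_eq_norm_sq]
    linarith
  have hmono : MonotoneOn (fun t => ‖r t‖ ^ 2 * Real.exp (-(t / 2))) (Iic T) := by
    refine monotoneOn_of_deriv_nonneg (convex_Iic T) ((hc.norm.pow 2).mul (by fun_prop)) ?_ ?_
    · rw [interior_Iic]
      exact fun t ht => (hd t ht).differentiableAt.differentiableWithinAt
    · rw [interior_Iic]
      intro t ht
      rw [(hd t ht).deriv]
      nlinarith [hin t (le_of_lt ht), Real.exp_pos (-(t / 2))]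
  have h := hmono ht self_mem_Iic ht
  refine (pow_le_pow_iff_left₀ (norm_nonneg _) (Real.exp_pos _).le two_ne_zero).1 ?_
  have h2 : ‖r T‖ ^ 2 ≤ 1 := pow_le_one₀ (norm_nonneg _) h1
  have e1 : Real.exp ((t - T) / 4) ^ 2 = Real.exp (-(T / 2)) * Real.exp (t / 2) := by
    rw [sq, ← Real.exp_add, ← Real.exp_add]; ring_nf
  have e2 : Real.exp (-(t / 2)) * Real.exp (t / 2) = 1 := by
    rw [← Real.exp_add]; simp
  rw [e1]
  calc ‖r t‖ ^ 2 = ‖r t‖ ^ 2 * Real.exp (-(t / 2)) * Real.exp (t / 2) := by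
        rw [mul_assoc, e2, mul_one]
    _ ≤ ‖r T‖ ^ 2 * Real.exp (-(T / 2)) * Real.exp (t / 2) :=
        mul_le_mul_of_nonneg_right h (Real.exp_pos _).le
    _ ≤ 1 * Real.exp (-(T / 2)) * Real.exp (t / 2) := by gcongr
    _ = _ := by rw [one_mul]

theorem hasDerivAt_exp_sub_div_four (c T t : ℝ) :
    HasDerivAt (fun t => c * Real.exp ((t - T) / 4)) (c / 4 * Real.exp ((t - T) / 4)) t := by
  refine (((((hasDerivAt_id t).sub_const T).div_const 4).exp).const_mul c).congr_deriv ?_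
  simp only [id]
  ring

/-- A curve whose velocity decays exponentially as `t → -∞` has a limit there. -/
theorem exists_tendsto_atBot_of_norm_deriv_le {E : Type*} [NormedAddCommGroup E]
    [NormedSpace ℝ E] [CompleteSpace E] {X X' : ℝ → E} {T : ℝ}
    (hX : ∀ t < T, HasDerivAt X (X' t) t) (hb : ∀ t < T, ‖X' t‖ ≤ Real.exp ((t - T) / 4)) :
    ∃ L, Tendsto X atBot (𝓝 L) := by
  -- The right-hand side is the integral of the speed bound over `(-∞, t]`.
  have key : ∀ s t, s ≤ t → t < T → ‖X t - X s‖ ≤ 4 * Real.exp ((t - T) / 4) := by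
    intro s t hst ht
    have h := image_norm_le_of_norm_deriv_right_le_deriv_boundary (f := fun u => X u - X s)
      (a := s) (b := t) (f' := X')
      (fun u hu => ((hX u (hu.2.trans_lt ht)).continuousAt.sub
        continuousAt_const).continuousWithinAt)
      (fun u hu => ((hX u (hu.2.trans ht)).sub_const _).hasDerivWithinAt)
      (B := fun u => 4 * Real.exp ((u - T) / 4)) (by simp; positivity)
      (hasDerivAt_exp_sub_div_four 4 T)
      (fun u hu => by simpa using hb u (hu.2.trans ht))
    exact h ⟨hst, le_rfl⟩
  have hlim : Tendsto (fun t : ℝ => 4 * Real.exp ((t - T) / 4)) atBot (𝓝 0) := by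
    have h : Tendsto (fun t : ℝ => Real.exp ((t - T) / 4)) atBot (𝓝 0) :=
      Real.tendsto_exp_atBot.comp
        ((tendsto_atBot_add_const_right _ (-T) tendsto_id).atBot_div_const four_pos)
    simpa using h.const_mul 4
  refine cauchy_map_iff_exists_tendsto.1 (Metric.cauchy_iff.2 ⟨inferInstance, fun ε hε => ?_⟩)
  obtain ⟨t, h1, h2⟩ := ((hlim.eventually_lt_const (half_pos hε)).and
    (eventually_lt_atBot T)).exists
  refine ⟨X '' Iic t, image_mem_map (Iic_mem_atBot t), ?_⟩
  rintro _ ⟨u, hu, rfl⟩ _ ⟨v, hv, rfl⟩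
  have hmain : ∀ u ≤ t, dist (X t) (X u) < ε / 2 := fun u hu => by
    rw [dist_eq_norm]; exact (key u t hu h2).trans_lt h1
  have := dist_triangle_left (X u) (X v) (X t)
  linarith [hmain u hu, hmain v hv]

/-- A Gronwall argument from `-∞`: if `H → 0` and `‖H'‖ ≤ 5 e^{(t - T)/4} ‖H‖`, then `H = 0`. -/
theorem eq_zero_of_norm_deriv_le {E : Type*} [NormedAddCommGroup E] [NormedSpace ℝ E]
    {H H' : ℝ → E} {T : ℝ} (hc : ContinuousOn H (Iic T))
    (hH : ∀ t < T, HasDerivAt H (H' t) t)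
    (hb : ∀ t < T, ‖H' t‖ ≤ 5 * Real.exp ((t - T) / 4) * ‖H t‖) (h0 : Tendsto H atBot (𝓝 0)) :
    H T = 0 := by
  -- The comparison function has logarithmic derivative `6 e^{(t-T)/4}`, strictly above the
  -- coefficient `5 e^{(t-T)/4}`; the summand `e^s` keeps it positive even if `H s = 0`.
  have key : ∀ s ≤ T, ‖H T‖ ≤ (‖H s‖ + Real.exp s) * Real.exp 24 := by
    intro s hs
    have hpos : 0 < ‖H s‖ + Real.exp s := by positivity
    have hB : ∀ t, HasDerivAt
        (fun t => (‖H s‖ + Real.exp s) * Real.exp (24 * Real.exp ((t - T) / 4)))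
        ((‖H s‖ + Real.exp s) * (Real.exp (24 * Real.exp ((t - T) / 4)) *
          (24 / 4 * Real.exp ((t - T) / 4)))) t := fun t =>
      (hasDerivAt_exp_sub_div_four 24 T t).exp.const_mul _
    have h := image_norm_le_of_norm_deriv_right_lt_deriv_boundary (a := s) (b := T)
      (hc.mono Icc_subset_Iic_self) (fun t ht => (hH t ht.2).hasDerivWithinAt)
      (B := fun t => (‖H s‖ + Real.exp s) * Real.exp (24 * Real.exp ((t - T) / 4))) ?_ hB ?_
      (x := T) ⟨hs, le_rfl⟩
    · simpa using h
    · have : 1 ≤ Real.exp (24 * Real.exp ((s - T) / 4)) := Real.one_le_exp (by positivity)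
      nlinarith [Real.exp_pos s, norm_nonneg (H s)]
    · intro t ht he
      refine (hb t ht.2).trans_lt ?_
      have h1 : 0 < Real.exp ((t - T) / 4) := Real.exp_pos _
      have h2 : 0 < (‖H s‖ + Real.exp s) * Real.exp (24 * Real.exp ((t - T) / 4)) := by
        positivity
      rw [he]
      nlinarith [mul_pos h1 h2]
  have hlim : Tendsto (fun s => (‖H s‖ + Real.exp s) * Real.exp 24) atBot (𝓝 0) := by
    simpa using (h0.norm.add Real.tendsto_exp_atBot).mul_const (Real.exp 24)
  have := ge_of_tendsto hlim ((eventually_le_atBot T).mono key)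
  exact norm_le_zero_iff.1 this

/-- The distance of a lifted solution from the disc state with the same order parameter obeys a
linear differential inequality. -/
theorem norm_kuramotoField_sub_fderiv_le (q : ℝ) (X : RealPhase) {w : ℂ}
    (hw : conj (orderParam (modTwoPi X)) = w) (hw2 : ‖w‖ ≤ 1 / 2) :
    ‖kuramotoField (modTwoPi X) - fderiv ℝ (discChart q) w
      (conj ((orderParam (modTwoPi X) - conj (orderParam (modTwoPi X))
        * secondMoment (modTwoPi X)) / 2))‖ ≤ 5 * ‖w‖ * ‖X - discChart q w‖ := by
  have hw1 : ‖w‖ < 1 := by linarith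
  have hr : orderParam (modTwoPi X) = conj w := by rw [← hw, Complex.conj_conj]
  have hae := ae_norm_phasor_modTwoPi_sub_le X (discChart q w)
  have h1 := norm_kuramotoField_sub_le_of_ae _ _ (norm_nonneg _) hae
  rw [orderParam_discChart q hw1, hr, sub_self, norm_zero, zero_add, RCLike.norm_conj] at h1
  have h2 := norm_secondMoment_sub_le_of_ae _ _ hae
  rw [secondMoment_discChart q hw1] at h2
  set m := secondMoment (modTwoPi X)
  have hn : w * conj w = ((‖w‖ ^ 2 : ℝ) : ℂ) := by
    rw [Complex.mul_conj, Complex.normSq_eq_norm_sq]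
  -- The velocity of `w` is the radial one plus an error from `m ≠ w̄²`. That error is at most
  -- `‖w‖‖X - discChart q w‖`, and the chart derivative multiplies it by at most `4`; the field
  -- difference contributes the remaining `1`.
  have e : conj ((orderParam (modTwoPi X) - conj (orderParam (modTwoPi X)) * m) / 2)
      = w * (1 - ‖w‖ ^ 2) / 2 + conj (-(w * (m - conj w ^ 2) / 2)) := by
    rw [hr]
    have h2 : conj (2 : ℂ) = 2 := Complex.conj_ofNat 2
    push_cast at hn
    simp only [map_neg, map_div₀, map_sub, map_mul, map_pow, Complex.conj_conj, h2]
    linear_combination (-w / 2) * hn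
  have h3 : ‖conj (-(w * (m - conj w ^ 2) / 2))‖ ≤ ‖w‖ * ‖X - discChart q w‖ := by
    rw [RCLike.norm_conj, norm_neg, norm_div, norm_mul, Complex.norm_ofNat]
    nlinarith [mul_le_mul_of_nonneg_left h2 (norm_nonneg w)]
  rw [e, map_add, fderiv_discChart_radial q hw1, ← sub_sub]
  refine (norm_sub_le _ _).trans ?_
  have h4 := norm_fderiv_discChart_le q hw2 (conj (-(w * (m - conj w ^ 2) / 2)))
  linarith

/-- A backward solution which converges to the twisted state lies on the disc at some time. -/
theorem IsSolutionOn.exists_mem_oaDisc (q : ℝ) {x : ℝ → CirclePhase}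
    (hx : IsSolutionOn x (Iic 0)) (hlim : Tendsto x atBot (𝓝 (twistedState q))) :
    ∃ T ≤ 0, x T ∈ oaDisc q := by
  obtain ⟨X, hX⟩ := hx
  have h01 : ‖(0 : ℂ)‖ < 1 := by simp
  have hr0 : Tendsto (fun t => orderParam (x t)) atBot (𝓝 0) := by
    have h := (continuous_orderParam.tendsto (twistedState q)).comp hlim
    rwa [← modTwoPi_discChart_zero, orderParam_discChart q h01, map_zero] at h
  have hm0 : Tendsto (fun t => secondMoment (x t)) atBot (𝓝 0) := by
    have h := (continuous_secondMoment.tendsto (twistedState q)).comp hlim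
    rwa [← modTwoPi_discChart_zero, secondMoment_discChart q h01, map_zero,
      zero_pow two_ne_zero] at h
  have hhalf : (0 : ℝ) < 1 / 2 := by norm_num
  obtain ⟨T, hT⟩ := eventually_atBot.1 (((hr0.norm.eventually_lt_const (u := 1 / 2)
    (by rwa [norm_zero])).and (hm0.norm.eventually_lt_const (u := 1 / 2) (by rwa [norm_zero]))).and
    (eventually_le_atBot 0))
  have hT0 : T ≤ 0 := (hT T le_rfl).2
  have hrT : ∀ t ≤ T, ‖orderParam (x t)‖ ≤ 1 / 2 := fun t ht => (hT t ht).1.1.le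
  have hnhds : ∀ t < T, Iic (0 : ℝ) ∈ 𝓝 t := fun t ht => Iic_mem_nhds (ht.trans_le hT0)
  have hXd : ∀ t < T, HasDerivAt X (kuramotoField (x t)) t := fun t ht =>
    (hX t (ht.le.trans hT0)).2.hasDerivAt (hnhds t ht)
  have hrd : ∀ t ≤ 0, HasDerivWithinAt (fun s => orderParam (x s))
      ((orderParam (x t) - conj (orderParam (x t)) * secondMoment (x t)) / 2) (Iic 0) t :=
    fun t ht => hasDerivWithinAt_orderParam (fun s hs => (hX s hs).1) ht (hX t ht).2
  have hrc : ContinuousOn (fun s => orderParam (x s)) (Iic T) := fun t ht =>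
    (hrd t (le_trans ht hT0)).continuousWithinAt.mono (Iic_subset_Iic.2 hT0)
  have hXc : ContinuousOn X (Iic T) := fun t ht =>
    (hX t (le_trans ht hT0)).2.continuousWithinAt.mono (Iic_subset_Iic.2 hT0)
  have hexp : ∀ t ≤ T, ‖orderParam (x t)‖ ≤ Real.exp ((t - T) / 4) := fun t ht =>
    norm_le_exp_of_hasDerivAt hrc (fun t ht => (hrd t (ht.le.trans hT0)).hasDerivAt (hnhds t ht))
      (fun t ht => (hT t ht).1.2.le) (norm_orderParam_le _) ht
  obtain ⟨L, hL⟩ := exists_tendsto_atBot_of_norm_deriv_le hXd fun t ht =>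
    (norm_kuramotoField_le _).trans (hexp t ht.le)
  have hmodL : modTwoPi L = twistedState q := by
    refine tendsto_nhds_unique ((continuous_modTwoPi.tendsto L).comp hL) (hlim.congr' ?_)
    filter_upwards [eventually_le_atBot 0] with t ht
    exact (hX t ht).1.symm
  -- Both lifts represent `y_q`, so `c` is `0` mod `2π`; subtracting it makes the shifted lift
  -- converge to `discChart q 0`.
  set c : RealPhase := L - discChart q 0 with hc
  have hmodc : ∀ Z, modTwoPi (Z - c) = modTwoPi Z := fun Z => by
    rw [modTwoPi_sub, hc, modTwoPi_sub, hmodL, modTwoPi_discChart_zero, sub_self, sub_zero]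
  set w : ℝ → ℂ := fun t => conj (orderParam (x t)) with hw
  have hwn : ∀ t, ‖w t‖ = ‖orderParam (x t)‖ := fun t => RCLike.norm_conj _
  have hw2 : ∀ t ≤ T, ‖w t‖ ≤ 1 / 2 := fun t ht => (hwn t).trans_le (hrT t ht)
  have hw1 : ∀ t ≤ T, ‖w t‖ < 1 := fun t ht => (hw2 t ht).trans_lt (by norm_num)
  have hwc : ContinuousOn w (Iic T) := Complex.continuous_conj.comp_continuousOn hrc
  -- The comparison curve on the disc has the same order parameter as the solution at every time; it
  -- is not assumed to be a solution.
  have hzero : X T - c - discChart q (w T) = 0 := by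
    refine eq_zero_of_norm_deriv_le (H := fun t => X t - c - discChart q (w t))
      (H' := fun t => kuramotoField (x t) - fderiv ℝ (discChart q) (w t)
        (conj ((orderParam (x t) - conj (orderParam (x t)) * secondMoment (x t)) / 2)))
      ?_ ?_ ?_ ?_
    · refine (hXc.sub continuousOn_const).sub ((continuousOn_discChart q).comp hwc ?_)
      exact fun t ht => mem_ball_zero_iff.2 (hw1 t ht)
    · intro t ht
      have hwd : HasDerivAt w
          (conj ((orderParam (x t) - conj (orderParam (x t)) * secondMoment (x t)) / 2)) t :=
        Complex.conjCLE.hasFDerivAt.comp_hasDerivAt t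
          ((hrd t (ht.le.trans hT0)).hasDerivAt (hnhds t ht))
      exact ((hXd t ht).sub_const c).sub
        ((differentiableAt_discChart q (hw1 t ht.le)).hasFDerivAt.comp_hasDerivAt t hwd)
    · intro t ht
      have hxt : modTwoPi (X t - c) = x t := by
        rw [hmodc, (hX t (ht.le.trans hT0)).1]
      have h := norm_kuramotoField_sub_fderiv_le q (X t - c) (w := w t) (by rw [hxt])
        (hw2 t ht.le)
      rw [hxt] at h
      refine h.trans ?_
      gcongr
      exact (hwn t).trans_le (hexp t ht.le)
    · have hw0 : Tendsto w atBot (𝓝 0) := by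
        have := (Complex.continuous_conj.tendsto 0).comp hr0
        rwa [map_zero] at this
      have h1 : Tendsto (fun t => discChart q (w t)) atBot (𝓝 (discChart q 0)) :=
        ((differentiableAt_discChart q h01).continuousAt.tendsto).comp hw0
      have h2 := (hL.sub_const c).sub h1
      rwa [hc, sub_sub_cancel, sub_self] at h2
  refine ⟨T, hT0, w T, mem_ball_zero_iff.2 (hw1 T le_rfl), ?_⟩
  change modTwoPi (discChart q (w T)) = x T
  rw [← (hX T hT0).1, ← hmodc (X T), sub_eq_zero.1 hzero]

/-- The solution meets the disc at some `T ≤ 0`, and uniqueness transports this to time `0`. -/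
theorem unstableManifold_twistedState (q : ℝ) :
    unstableManifold (twistedState q) = oaDisc q := by
  refine Subset.antisymm ?_ (oaDisc_subset_unstableManifold q)
  rintro _ ⟨x, hx, rfl, hlim⟩
  obtain ⟨T, hT, hxT⟩ := hx.exists_mem_oaDisc q hlim
  obtain ⟨α, -, b, hb, h⟩ := hx.exists_radialSolution q ordConnected_Iic hT hxT
  rw [h 0 self_mem_Iic]
  exact ⟨_, mem_ball_zero_iff.2 (polar_radialSolution_mem_ball hb α 0), rfl⟩

theorem kuramotoField_twistedState (q : ℝ) : kuramotoField (twistedState q) = 0 := by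
  have h := norm_kuramotoField_le (twistedState q)
  rw [← modTwoPi_discChart_zero, orderParam_discChart q (by simp), map_zero, norm_zero] at h
  rw [← modTwoPi_discChart_zero]
  exact norm_le_zero_iff.1 h

end Kuramoto

end

theorem mainTheorem1 (q : ℝ) :
    -- the twisted state is an equilibrium
    kuramotoField (twistedState q) = 0 ∧
    -- explicit form of its unstable manifold
    unstableManifold (twistedState q) =
      {x : CirclePhase | ∃ β ∈ Ico (0 : ℝ) 1, ∃ α ∈ Icc (-π) π, x =ᵐ[volume] oaState q α β} ∧
    -- it is a two-dimensional manifold, with `(β, α)` as polar coordinates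
    (∃ Φ : ℂ → RealPhase, IsSmoothDisc (unstableManifold (twistedState q)) Φ ∧
      ∀ β ∈ Ico (0 : ℝ) 1, ∀ α : ℝ,
        modTwoPi (Φ (β * Complex.exp (α * Complex.I))) =ᵐ[volume] oaState q α β) ∧
    -- backward solutions on it converge exponentially, with the rate `1/2`
    (∀ x : ℝ → CirclePhase, IsSolutionOn x (Iic 0) →
      x 0 ∈ unstableManifold (twistedState q) →
      ∃ K : ℝ, ∀ t ≤ 0, dist (x t) (twistedState q) ≤ K * Real.exp (t / 2)) ∧
    -- a differentiable curve on it is a solution iff its parameters solve the ODEs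
    (∀ (J : Set ℝ) (α β : ℝ → ℝ) (x : ℝ → CirclePhase), J.OrdConnected →
      DifferentiableOn ℝ α J → DifferentiableOn ℝ β J →
      (∀ t ∈ J, β t ∈ Ico (0 : ℝ) 1 ∧ x t =ᵐ[volume] oaState q (α t) (β t)) →
      (IsSolutionOn x J ↔ SolvesParameterODE α β J)) ∧
    -- a solution that meets it stays on it, and is given by a solution of the ODEs
    (∀ (J : Set ℝ) (x : ℝ → CirclePhase), J.OrdConnected → IsSolutionOn x J →
      (∃ t ∈ J, x t ∈ unstableManifold (twistedState q)) →
      ∃ α ∈ Icc (-π) π, ∃ β : ℝ → ℝ, SolvesParameterODE (fun _ => α) β J ∧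
        ∀ t ∈ J, β t ∈ Ico (0 : ℝ) 1 ∧ x t =ᵐ[volume] oaState q α (β t)) := by
  rw [unstableManifold_twistedState]
  refine ⟨kuramotoField_twistedState q, ?_, ?_, ?_, ?_, ?_⟩
  · ext x
    exact mem_oaDisc_iff q x
  · exact ⟨discChart q, isSmoothDisc_oaDisc q, fun β hβ α => modTwoPi_discChart_polar q hβ α⟩
  · intro x hx h0
    obtain ⟨α, -, b, hb, h⟩ := hx.exists_radialSolution q ordConnected_Iic self_mem_Iic h0
    refine ⟨4 * π * b, fun t ht => ?_⟩
    rw [h t ht]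
    exact dist_radialSolution_le q α hb t
  · intro J α β x hJ hα hβ hx
    exact ⟨solvesParameterODE_of_isSolutionOn q hJ hα hβ hx,
      isSolutionOn_of_solvesParameterODE q hα hx⟩
  · rintro J x hJ hx ⟨t₀, ht₀, h0⟩
    obtain ⟨α, hα, b, hb, h⟩ := hx.exists_radialSolution q hJ ht₀ h0
    refine ⟨α, hα, radialSolution b, fun t _ =>
      ⟨(hasDerivAt_radialSolution b t).hasDerivWithinAt, fun _ => hasDerivWithinAt_const t J α⟩,
      fun t ht => ⟨radialSolution_mem hb t, ?_⟩⟩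
    rw [ae_eq_oaState_iff q (radialSolution_mem hb t)]
    exact h t ht
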